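/- **Setting.** Consider a Block MDP with finite latent state space, a finite set of $A\ge 1$ actions, initial law $\mu$, transitions $T$, deterministic rewards $R\in[0,1]$, horizon $H\ge 1$, and (discrete) emission laws $q(\cdot\mid s)$ with pairwise disjoint supports, so that a decoder $\phi^\star$ with $\phi^\star(x)=s$ for all $x\in\operatorname{supp} q(\cdot\mid s)$ exists. For an observation-based policy $\pi$ let $V(\pi)$ be its expected total reward over $H$ steps. Let $\mathcal S$ be the set of latent states that some policy reaches with positive probability during steps $1,\dots,H$, and $S=|\mathcal S|$. **Data.** A video is the observation sequence $x_1,\dots,x_{H+K}$ of an episode (continued past step $H$) generated by a policy drawn from a mixture $\Theta$ of Markovian policies; $D$ denotes the resulting law. Every policy in the mixture is noise-free: on observations it can meet at step $h$, its action law depends only on $\phi^\star(x_h)$ and $h$. For a policy class $\Pi$ and $\eta_{\min}>0$ assume: if some $\pi\in\Pi$ has $\mathbb P_\pi(s_h=s)>0$ with $h\le H$, then $D(\phi^\star(x_h)=s)\ge\eta_{\min}$; and each $s\in\mathcal S$ is reached at some step $h\le H$ by some $\pi\in\Pi$. Let $D_{pr}$ be the law of $(x,k,x')=(x_h,k,x_{h+k})$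 where the video is drawn from $D$, $h$ uniformly from $\{1,\dots,H\}$ and $k$ from a given law $\omega$ on $\{1,\dots,K\}$ (for instance a point mass or the uniform law), independently. **Learning.** Let $\Phi$ be a finite class of decoders $\phi:\mathcal X\to\{1,\dots,S\}$ and $\mathcal F$ a finite class of conditional laws $f(\cdot\mid i,k)$ on $\mathcal X$, $i\in\{1,\dots,S\}$, $k\in\{1,\dots,K\}$. Assume realizability: there are $f^\circ\in\mathcal F$, $\phi^\circ\in\Phi$ with $f^\circ(x'\mid\phi^\circ(x),k)=D_{pr}(x'\mid x,k)$ for all $x'$ and all $(x,k)$ in the support of $D_{pr}$; and a margin $\beta_{\mathrm{for}}>0$: for all $s_1\neq s_2$ in $\mathcal S$, $\mathbb E_{k\sim\omega}\|D_{pr}(X'\mid s_1,k)-D_{pr}(X'\mid s_2,k)\|_{\mathrm{TV}}\ge\beta_{\mathrm{for}}$, where $D_{pr}(\cdot\mid s,k)$ is conditional on $\phi^\star(x)=s$ and $k$. Given $n$ i.i.d. samples $(x^{(i)},k^{(i)},x'^{(i)})\sim D_{pr}$ let $(\hat f,\hat\phi)$ be any maximizer over $\mathcal F\times\Phi$ of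 $\frac1n\sum_{i}\ln f(x'^{(i)}\mid\phi(x^{(i)}),k^{(i)})$. **Tabular RL.** Let $\mathscr A$ be a PAC RL algorithm for tabular MDPs with sample complexity $n_{\mathrm{samp}}$: for all $S,A,H$, $\epsilon>0$, $\delta\in(0,1)$ and every tabular MDP with $S$ states, $A$ actions and horizon $H$, it interacts for $n_{\mathrm{samp}}(S,A,H,\epsilon,\delta)$ episodes and returns a policy $\hat\varphi:\{1,\dots,S\}\times\{1,\dots,H\}\to\{1,\dots,A\}$ which with probability at least $1-\delta$ is $\epsilon$-optimal. **Theorem.** There is an absolute constant $C>0$ such that, in this setting, for all $\epsilon>0$ and $\delta\in(0,1)$: if $$n\ \ge\ C\left\{\frac{S^4H^4}{\eta_{\min}^4\beta_{\mathrm{for}}^2}+\frac{S^6H^8}{\epsilon^2\eta_{\min}^4\beta_{\mathrm{for}}^2}+\frac{S^6H^6\,n_{\mathrm{samp}}(S,A,H,\epsilon/2,\delta/4)^2}{\delta^2\eta_{\min}^4\beta_{\mathrm{for}}^2}\right\}\ln\frac{|\mathcal F||\Phi|}{\delta},$$ and $\mathscr A$, with parameters $\epsilon/2$ and $\delta/4$,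 is run in the Block MDP with every observation $x$ replaced by $\hat\phi(x)$, for $n_{\mathrm{samp}}(S,A,H,\epsilon/2,\delta/4)$ online episodes (a number that does not depend on $\Phi$ or $\mathcal F$), returning $\hat\varphi$, then with probability at least $1-\delta$ (over the data, the online episodes and the randomness of $\mathscr A$) both of the following hold: there is a bijection $\alpha:\mathcal S\to\{1,\dots,S\}$ with $$\forall s\in\mathcal S:\quad \mathbb P_{x\sim q(\cdot\mid s)}\big(\hat\phi(x)=\alpha(s)\big)\ \ge\ 1-\frac{4S^3H^2}{\eta_{\min}^2\beta_{\mathrm{for}}}\sqrt{\frac1n\ln\frac{|\mathcal F||\Phi|}{\delta}},$$ and the policy $\hat\varphi\circ\hat\phi:(x,h)\mapsto\hat\varphi(\hat\phi(x),h)$ satisfies $V(\pi)-V(\hat\varphi\circ\hat\phi)\le\epsilon$ for every Markovian observation-based policy $\pi$. -/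

import Mathlib

open scoped ENNReal

noncomputable section

/-- A finite-horizon tabular MDP (state space `S`, action space `A`): initial law, transition
kernel and deterministic rewards in `[0,1]`.  The horizon is supplied separately. -/
structure TabularMDP (S A : Type*) where
  /-- Law of the first state. -/
  init : PMF S
  /-- Transition kernel. -/
  trans : S → A → PMF S
  /-- Reward function. -/
  reward : S → A → ℝ
  reward_nonneg : ∀ s a, 0 ≤ reward s a
  reward_le_one : ∀ s a, reward s a ≤ 1

/-- A Block MDP: a latent tabular MDP, an emission law for every latent state, and the decoder
given by the disjointness of the supports of the emission laws. -/
structure BlockMDP (X S A : Type*) extends TabularMDP S A where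
  /-- Emission law `q(· ∣ s)`. -/
  emit : S → PMF X
  /-- The true decoder `φ⋆`. -/
  dec : X → S
  dec_of_mem_support : ∀ s, ∀ x ∈ (emit s).support, dec x = s

/-- A tabular MDP is a Block MDP whose observations are the states themselves. -/
def TabularMDP.toBlock {S A : Type*} (M : TabularMDP S A) : BlockMDP S S A where
  toTabularMDP := M
  emit := PMF.pure
  dec := id
  dec_of_mem_support := by
    intro s x hx
    simpa using hx

/-- Markovian, possibly randomized and time-dependent, observation-based policies.
Time starts at `0`, so that the `h`-th step in `{1, …, H}` is the index `h - 1`. -/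
abbrev ObsPolicy (X A : Type*) := ℕ → X → PMF A

/-- The observation-based policy `ϕ ∘ φ` at time `h` plays `ϕ h (φ x)`. -/
def composePolicy {X Z A : Type*} (ϕ : ℕ → Z → A) (φ : X → Z) : ObsPolicy X A :=
  fun h x => PMF.pure (ϕ h (φ x))

namespace BlockMDP

variable {X S A : Type*}

/-- Law of the next `m` steps `(state, observation, action)` when the state is `s` at time `t`
and actions are taken by `π`. -/
def episodeFrom (M : BlockMDP X S A) (π : ObsPolicy X A) :
    (m : ℕ) → ℕ → S → PMF (Fin m → S × X × A)
  | 0, _, _ => PMF.pure Fin.elim0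
  | m + 1, t, s =>
    (M.emit s).bind fun x => (π t x).bind fun a => (M.trans s a).bind fun s' =>
      (M.episodeFrom π m (t + 1) s').map fun τ =>
        (Fin.cons (s, x, a) τ : Fin (m + 1) → S × X × A)

/-- Law of an episode of length `m` generated by `π`. -/
def episode (M : BlockMDP X S A) (π : ObsPolicy X A) (m : ℕ) : PMF (Fin m → S × X × A) :=
  M.init.bind (M.episodeFrom π m 0)

/-- The value `V(π)`: the expected total reward over `H` steps. -/
def value (M : BlockMDP X S A) (H : ℕ) (π : ObsPolicy X A) : ℝ :=
  ∑' τ : Fin H → S × X × A,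
    (M.episode π H τ).toReal * ∑ h : Fin H, M.reward (τ h).1 (τ h).2.2

/-- Law under `π` of the latent state at time `h`. -/
def stateLaw (M : BlockMDP X S A) (π : ObsPolicy X A) (h : ℕ) : PMF S :=
  (M.episode π (h + 1)).map fun τ => (τ (Fin.last h)).1

/-- Law under `π` of the observation at time `h`. -/
def obsLaw (M : BlockMDP X S A) (π : ObsPolicy X A) (h : ℕ) : PMF X :=
  (M.episode π (h + 1)).map fun τ => (τ (Fin.last h)).2.1

/-- The latent states that some policy visits during the first `H` steps. -/
def visited (M : BlockMDP X S A) (H : ℕ) : Set S :=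
  {s | ∃ h < H, ∃ π : ObsPolicy X A, 0 < M.stateLaw π h s}

/-- Law of a video (the observations of an episode) with `m` frames: a policy is drawn from the
mixture `Θ` and then generates the entire episode. -/
def videoLaw (M : BlockMDP X S A) (Θ : PMF (ObsPolicy X A)) (m : ℕ) : PMF (Fin m → X) :=
  Θ.bind fun π => (M.episode π m).map fun τ i => (τ i).2.1

/-- Law of a multistep transition `(x, k, x')`: draw a video with `H + K` frames, a time
uniformly among the first `H` ones and a gap from `ω`, independently; `x'` is observed
gap-many steps after `x`.  The gap `k ∈ {1, …, K}` is represented by `k - 1 : Fin K`. -/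
def multistepLaw (M : BlockMDP X S A) (Θ : PMF (ObsPolicy X A)) (H K : ℕ) [NeZero H]
    (ω : PMF (Fin K)) : PMF (X × Fin K × X) :=
  (M.videoLaw Θ (H + K)).bind fun v =>
    (PMF.uniformOfFintype (Fin H)).bind fun h =>
      ω.map fun k =>
        (v ⟨h.1, by have := h.2; omega⟩, k, v ⟨h.1 + (k.1 + 1), by have := h.2; have := k.2; omega⟩)

/-- Coverage by the data with constant `η`, relative to the policy class `Pol`: a state that a
policy in `Pol` reaches at time `h` has probability at least `η` at time `h` under the data, and
every state that can be visited within the horizon is visited by a policy in `Pol`. -/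
structure Covers (M : BlockMDP X S A) (H : ℕ) (Pol : Set (ObsPolicy X A))
    (Θ : PMF (ObsPolicy X A)) (η : ℝ) : Prop where
  visit : ∀ s ∈ M.visited H, ∃ h < H, ∃ π ∈ Pol, 0 < M.stateLaw π h s
  cover : ∀ h < H, ∀ s, (∃ π ∈ Pol, 0 < M.stateLaw π h s) →
    ENNReal.ofReal η ≤ (Θ.bind fun π => M.stateLaw π h) s

/-- Every policy in the mixture is noise-free: on the observations that it can meet, it depends
only on the latent state (and time). -/
def NoiseFree (M : BlockMDP X S A) (Θ : PMF (ObsPolicy X A)) : Prop :=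
  ∀ π ∈ Θ.support, ∃ σ : ℕ → S → PMF A,
    ∀ h, ∀ x ∈ (M.obsLaw π h).support, π h x = σ h (M.dec x)

end BlockMDP

section ForwardModeling

variable {X S : Type*} {N K n : ℕ}

/-- Conditional probability `P(x' ∣ x, k)`. -/
def condObs (P : PMF (X × Fin K × X)) (x : X) (k : Fin K) (x' : X) : ℝ≥0∞ :=
  P (x, k, x') / P.toOuterMeasure {p | p.1 = x ∧ p.2.1 = k}

/-- Conditional probability `P(x' ∣ φ⋆(x) = s, k)`. -/
def condState (P : PMF (X × Fin K × X)) (dec : X → S) (s : S) (k : Fin K) (x' : X) : ℝ≥0∞ :=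
  P.toOuterMeasure {p | dec p.1 = s ∧ p.2.1 = k ∧ p.2.2 = x'} /
    P.toOuterMeasure {p | dec p.1 = s ∧ p.2.1 = k}

/-- Total variation distance of two probability mass functions. -/
def tvDist (p q : X → ℝ≥0∞) : ℝ :=
  (1 / 2) * ∑' x, |(p x).toReal - (q x).toReal|

/-- Realizability: some model and decoder in the two classes give the conditional law of `x'`
at every `(x, k)` of positive probability. -/
def Realizable (P : PMF (X × Fin K × X)) (F : Finset (Fin N → Fin K → PMF X))
    (Φ : Finset (X → Fin N)) : Prop :=
  ∃ f ∈ F, ∃ φ ∈ Φ, ∀ x k, 0 < P.toOuterMeasure {p | p.1 = x ∧ p.2.1 = k} →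
    ∀ x', f (φ x) k x' = condObs P x k x'

/-- The forward-modeling margin over the states in `V` is at least `β`. -/
def ForwardMargin (P : PMF (X × Fin K × X)) (dec : X → S) (ω : PMF (Fin K)) (V : Set S)
    (β : ℝ) : Prop :=
  ∀ s₁ ∈ V, ∀ s₂ ∈ V, s₁ ≠ s₂ →
    β ≤ ∑ k, (ω k).toReal * tvDist (condState P dec s₁ k) (condState P dec s₂ k)

/-- Log-likelihood of the data, with `ln 0 = -∞`; the factor `1/n` is omitted, since it does not
change the maximizers. -/
def logLikelihood (data : Fin n → X × Fin K × X) (f : Fin N → Fin K → PMF X)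
    (φ : X → Fin N) : EReal :=
  ∑ i, ENNReal.log (f (φ (data i).1) (data i).2.1 (data i).2.2)

/-- `(f̂, φ̂)` maximizes the likelihood over the two classes. -/
def IsMaxLikelihood (F : Finset (Fin N → Fin K → PMF X)) (Φ : Finset (X → Fin N))
    (data : Fin n → X × Fin K × X) (e : (Fin N → Fin K → PMF X) × (X → Fin N)) : Prop :=
  e.1 ∈ F ∧ e.2 ∈ Φ ∧
    ∀ f ∈ F, ∀ φ ∈ Φ, logLikelihood data f φ ≤ logLikelihood data e.1 e.2

/-- Law of `n` independent draws from `P`. -/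
def iidLaw {Y : Type*} (P : PMF Y) : (n : ℕ) → PMF (Fin n → Y)
  | 0 => PMF.pure Fin.elim0
  | n + 1 => P.bind fun y => (iidLaw P n).map fun v => (Fin.cons y v : Fin (n + 1) → Y)

end ForwardModeling

/-- The record of one episode seen by a tabular learner: states, actions, rewards. -/
abbrev Transcript (Z A : Type*) := List (Z × A × ℝ)

/-- An interactive, adaptive and possibly randomized tabular learner: the next action depends on
the past episodes, on the current partial episode and on the current state; the returned policy
depends on all episodes. -/
structure TabularLearner (Z A : Type*) where
  act : List (Transcript Z A) → Transcript Z A → Z → PMF A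
  output : List (Transcript Z A) → PMF (ℕ → Z → A)

namespace TabularLearner

variable {X S Z A : Type*}

/-- The remaining `m` steps of an episode from the latent state `s`, the learner seeing `φ x` in
place of the observation `x`. -/
def playFrom (L : TabularLearner Z A) (M : BlockMDP X S A) (φ : X → Z)
    (past : List (Transcript Z A)) : ℕ → Transcript Z A → S → PMF (Transcript Z A)
  | 0, cur, _ => PMF.pure cur
  | m + 1, cur, s =>
    (M.emit s).bind fun x => (L.act past cur (φ x)).bind fun a => (M.trans s a).bind fun s' =>
      L.playFrom M φ past m (cur ++ [(φ x, a, M.reward s a)]) s'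

/-- Law of the transcripts of the first `e` episodes of length `H`. -/
def playEpisodes (L : TabularLearner Z A) (M : BlockMDP X S A) (φ : X → Z) (H : ℕ) :
    ℕ → PMF (List (Transcript Z A))
  | 0 => PMF.pure []
  | e + 1 => (L.playEpisodes M φ H e).bind fun past =>
      (M.init.bind (L.playFrom M φ past H [])).map fun τ => past ++ [τ]

/-- Law of the policy returned after `e` episodes of length `H`. -/
def run (L : TabularLearner Z A) (M : BlockMDP X S A) (φ : X → Z) (H e : ℕ) :
    PMF (ℕ → Z → A) :=
  (L.playEpisodes M φ H e).bind L.output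

end TabularLearner

/-- A tabular RL algorithm: for all sizes `S`, `A`, `H` and parameters `ε`, `δ`, a learner and
the number of episodes `n_samp(S, A, H, ε, δ)` for which it interacts. -/
structure TabularAlgorithm where
  nsamp : (S A H : ℕ) → (ε δ : ℝ) → ℕ
  learner : (S A H : ℕ) → [NeZero A] → (ε δ : ℝ) → TabularLearner (Fin S) (Fin A)

/-- The PAC guarantee: on every tabular MDP the returned policy is `ε`-optimal with probability
at least `1 - δ`. -/
def TabularAlgorithm.IsPAC (alg : TabularAlgorithm) : Prop :=
  ∀ (S A H : ℕ) [NeZero A] (ε δ : ℝ), 0 < ε → 0 < δ → δ < 1 →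
    ∀ M : TabularMDP (Fin S) (Fin A),
      ENNReal.ofReal (1 - δ) ≤
        ((alg.learner S A H ε δ).run M.toBlock id H (alg.nsamp S A H ε δ)).toOuterMeasure
          {ϕ | ∀ ψ : ℕ → Fin S → Fin A,
            M.toBlock.value H (composePolicy ψ id) - M.toBlock.value H (composePolicy ϕ id) ≤ ε}

end

/-! Noise-freeness is what makes the data informative. The action at `x` is a function of the latent
state and time, so the data law factors as `q(x ∣ s) ω(k) W(s, k, x')` with `s = φ⋆(x)`
(`exists_multistepLaw_eq`). Given `(x, k)`, the law of `x'` thus depends on `x` only through `s`.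
The mass of `s` is its occupancy, at least `η / H` on visited states.

Maximum likelihood over finite classes is controlled by a Chernoff bound: a model with Bhattacharyya
coefficient `b` against the truth beats it on `n` samples with probability at most `b ^ n`. A union
bound leaves only models within `ℓ¹` distance `2 √(6 l)` of the truth, where `l = ln(|F||Φ|/δ) / n`
(`iidLaw_mle_le`).

Let `d(s, i)` be the `ω`-averaged `ℓ¹` distance from the conditional law at `s` to the model at
label `i`. Disintegrating the total distance bounds the mean of `d(s, φ̂(x))` over `x ∼ q(· ∣ s)`
(`mul_expect_l1Dist_le`). The margin and the triangle inequality give `d(s₁, i) + d(s₂, i) ≥ 2β`, so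
a label is within `β` of at most one state. Each visited state has such a label and there are as
many labels as visited states, so this is a bijection. A wrong label costs at least `β`, and
Markov's inequality bounds its probability (`exists_decoding`).

With an exact decoder the learner interacts with a relabelled tabular MDP, where the PAC guarantee
applies (`run_relabel`). With decoding error `e`, each online step adds at most `e` to the
probability of any event (`toOuterMeasure_run_le`), and the returned policy loses at most `H² e` in
value (`value_le_add`). The last two terms of the sample size make these errors at most `δ/4` and
`ε/4`. -/

noncomputable section

/-! ### Expectations in `ℝ≥0∞`, free of summability conditions -/

namespace PMF

variable {α β γ : Type*}

/-- The expectation of a nonnegative function under a probability mass function. -/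
def expect (p : PMF α) (g : α → ℝ≥0∞) : ℝ≥0∞ := ∑' a, p a * g a

@[simp] lemma expect_pure (a : α) (g : α → ℝ≥0∞) : (PMF.pure a).expect g = g a := by
  classical
  unfold expect
  rw [tsum_eq_single a]
  · simp
  · intro b hb
    simp [PMF.pure_apply, hb]

lemma expect_bind (p : PMF α) (f : α → PMF β) (g : β → ℝ≥0∞) :
    (p.bind f).expect g = p.expect fun a => (f a).expect g := by
  unfold expect
  simp_rw [PMF.bind_apply, ← ENNReal.tsum_mul_right, ← ENNReal.tsum_mul_left]
  rw [ENNReal.tsum_comm]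
  simp_rw [mul_assoc]

lemma expect_map (p : PMF α) (f : α → β) (g : β → ℝ≥0∞) :
    (p.map f).expect g = p.expect fun a => g (f a) := by
  rw [← PMF.bind_pure_comp, expect_bind]
  simp

@[simp] lemma expect_const (p : PMF α) (c : ℝ≥0∞) : (p.expect fun _ => c) = c := by
  unfold expect
  rw [ENNReal.tsum_mul_right, p.tsum_coe, one_mul]

lemma expect_congr {p : PMF α} {g g' : α → ℝ≥0∞} (h : ∀ a ∈ p.support, g a = g' a) :
    p.expect g = p.expect g' := by
  refine tsum_congr fun a => ?_
  by_cases ha : p a = 0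
  · simp [ha]
  · rw [h a ((p.mem_support_iff a).2 ha)]

lemma expect_mono {p : PMF α} {g g' : α → ℝ≥0∞} (h : ∀ a ∈ p.support, g a ≤ g' a) :
    p.expect g ≤ p.expect g' := by
  refine ENNReal.tsum_le_tsum fun a => ?_
  by_cases ha : p a = 0
  · simp [ha]
  · exact mul_le_mul_right (h a ((p.mem_support_iff a).2 ha)) _

lemma expect_le_of_le {p : PMF α} {g : α → ℝ≥0∞} {c : ℝ≥0∞} (h : ∀ a ∈ p.support, g a ≤ c) :
    p.expect g ≤ c := (expect_mono h).trans_eq (p.expect_const c)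

lemma expect_add (p : PMF α) (g g' : α → ℝ≥0∞) :
    (p.expect fun a => g a + g' a) = p.expect g + p.expect g' := by
  unfold expect
  simp_rw [mul_add]
  exact ENNReal.tsum_add

lemma expect_add_const (p : PMF α) (g : α → ℝ≥0∞) (c : ℝ≥0∞) :
    (p.expect fun a => g a + c) = p.expect g + c := by
  rw [expect_add, expect_const]

lemma expect_const_mul (p : PMF α) (g : α → ℝ≥0∞) (c : ℝ≥0∞) :
    (p.expect fun a => c * g a) = c * p.expect g := by
  unfold expect
  rw [← ENNReal.tsum_mul_left]
  exact tsum_congr fun a => by ring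

lemma expect_comm (p : PMF α) (q : PMF β) (g : α → β → ℝ≥0∞) :
    (p.expect fun a => q.expect (g a)) = q.expect fun b => p.expect fun a => g a b := by
  unfold expect
  simp_rw [← ENNReal.tsum_mul_left]
  rw [ENNReal.tsum_comm]
  exact tsum_congr fun b => tsum_congr fun a => by ring

lemma expect_tsum (p : PMF α) (g : α → β → ℝ≥0∞) :
    (p.expect fun a => ∑' b, g a b) = ∑' b, p.expect fun a => g a b := by
  unfold expect
  simp_rw [← ENNReal.tsum_mul_left]
  exact ENNReal.tsum_comm

lemma expect_single [DecidableEq α] (p : PMF α) (a : α) (c : α → ℝ≥0∞) :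
    (p.expect fun b => if b = a then c b else 0) = p a * c a := by
  unfold expect
  rw [tsum_eq_single a]
  · simp
  · intro b hb
    simp [hb]

lemma toOuterMeasure_eq_expect (p : PMF α) (s : Set α) :
    p.toOuterMeasure s = p.expect (s.indicator 1) := by
  rw [PMF.toOuterMeasure_apply]
  refine tsum_congr fun a => ?_
  by_cases h : a ∈ s <;> simp [h]

lemma toOuterMeasure_le_one (p : PMF α) (s : Set α) : p.toOuterMeasure s ≤ 1 := by
  rw [toOuterMeasure_eq_expect]
  refine expect_le_of_le fun a _ => ?_
  by_cases h : a ∈ s <;> simp [h]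

lemma toOuterMeasure_add_compl (p : PMF α) (s : Set α) :
    p.toOuterMeasure s + p.toOuterMeasure sᶜ = 1 := by
  rw [toOuterMeasure_eq_expect, toOuterMeasure_eq_expect, ← expect_add, ← p.expect_const 1]
  refine expect_congr fun a _ => ?_
  by_cases h : a ∈ s <;> simp [h]

/-- Two functions that are close outside a set of small probability have close expectations. -/
lemma expect_le_add_of_compl {p : PMF α} {u v : α → ℝ≥0∞} {B : Set α} {b c e : ℝ≥0∞}
    (hB : p.toOuterMeasure B ≤ e) (hu : ∀ a, u a ≤ b) (huv : ∀ a ∉ B, u a ≤ v a + c) :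
    p.expect u ≤ p.expect v + c + b * e := by
  calc p.expect u ≤ p.expect fun a => (v a + c) + b * B.indicator 1 a := by
        refine expect_mono fun a _ => ?_
        by_cases h : a ∈ B
        · simpa [h] using (hu a).trans le_add_self
        · simpa [h] using huv a h
    _ = p.expect v + c + b * p.toOuterMeasure B := by
        rw [expect_add, expect_add_const, expect_const_mul, ← toOuterMeasure_eq_expect]
    _ ≤ _ := by gcongr

/-- Point indicators separate laws, so equalities of laws can be proved by computing iterated
expectations. -/
lemma ext_expect {p q : PMF α} (h : ∀ g, p.expect g = q.expect g) : p = q := by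
  classical
  ext b
  have := h fun c => if c = b then 1 else 0
  rw [expect_single, expect_single] at this
  simpa using this

end PMF

/-! ### Latent dynamics and factorization of the multistep law -/

namespace BlockMDP

variable {X S A : Type*}

/-- Law of the next latent state. -/
def step (M : BlockMDP X S A) (π : ObsPolicy X A) (t : ℕ) (s : S) : PMF S :=
  (M.emit s).bind fun x => (π t x).bind (M.trans s)

/-- Law of the latent state `m` steps after it is `s` at time `t`. -/
def stateFrom (M : BlockMDP X S A) (π : ObsPolicy X A) : ℕ → ℕ → S → PMF S
  | 0, _, s => PMF.pure s
  | m + 1, t, s => (M.step π t s).bind (M.stateFrom π m (t + 1))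

/-- The recursion defining `stateFrom` splits off the first step; recursions in time need the last
step split off instead. -/
lemma stateFrom_succ (M : BlockMDP X S A) (π : ObsPolicy X A) (m t : ℕ) (s : S) :
    M.stateFrom π (m + 1) t s = (M.stateFrom π m t s).bind (M.step π (t + m)) := by
  induction m generalizing t s with
  | zero => simp [stateFrom]
  | succ m ih =>
    rw [stateFrom, funext (ih (t + 1)), ← PMF.bind_bind, stateFrom]
    congr! 2
    omega

lemma expect_step (M : BlockMDP X S A) (π : ObsPolicy X A) (t : ℕ) (s : S) (g : S → ℝ≥0∞) :
    (M.step π t s).expect g =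
      (M.emit s).expect fun x => (π t x).expect fun a => (M.trans s a).expect g := by
  simp_rw [step, PMF.expect_bind]

lemma expect_episodeFrom_succ (M : BlockMDP X S A) (π : ObsPolicy X A) (m t : ℕ) (s : S)
    (g : (Fin (m + 1) → S × X × A) → ℝ≥0∞) :
    (M.episodeFrom π (m + 1) t s).expect g =
      (M.emit s).expect fun x => (π t x).expect fun a => (M.trans s a).expect fun s' =>
        (M.episodeFrom π m (t + 1) s').expect fun τ => g (Fin.cons (s, x, a) τ) := by
  rw [episodeFrom]
  simp_rw [PMF.expect_bind, PMF.expect_map]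

lemma expect_episodeFrom_apply (M : BlockMDP X S A) (π : ObsPolicy X A) (m t : ℕ) (s : S)
    (i : Fin m) (g : S × X × A → ℝ≥0∞) :
    (M.episodeFrom π m t s).expect (fun τ => g (τ i)) =
      (M.stateFrom π i t s).expect fun s' => (M.emit s').expect fun x =>
        (π (t + i) x).expect fun a => g (s', x, a) := by
  induction m generalizing t s with
  | zero => exact i.elim0
  | succ m ih =>
    rw [expect_episodeFrom_succ]
    refine Fin.cases ?_ (fun i => ?_) i
    · simp [stateFrom]
    · simp only [Fin.cons_succ, Fin.val_succ]
      rw [stateFrom, PMF.expect_bind, expect_step]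
      simp_rw [ih]
      congr! 12
      omega

/-- Markov property at step `i`. One transition is displayed explicitly and `k` more remain, in
accordance with the gap being stored as its value minus one. Displaying the action exposes the only
dependence of the future on `x` beyond the state. -/
lemma expect_episodeFrom_apply_pair (M : BlockMDP X S A) (π : ObsPolicy X A) (m t : ℕ) (s : S)
    (i k : ℕ) (h : i + (k + 1) < m) (g : X → X → ℝ≥0∞) :
    (M.episodeFrom π m t s).expect
        (fun τ => g (τ ⟨i, by omega⟩).2.1 (τ ⟨i + (k + 1), h⟩).2.1) =
      (M.stateFrom π i t s).expect fun s' => (M.emit s').expect fun x =>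
        (π (t + i) x).expect fun a => (M.trans s' a).expect fun s'' =>
          (M.stateFrom π k (t + i + 1) s'').expect fun z => (M.emit z).expect (g x) := by
  induction m generalizing t s i with
  | zero => omega
  | succ m ih =>
    rw [expect_episodeFrom_succ]
    cases i with
    | zero =>
      have e : (⟨0 + (k + 1), h⟩ : Fin (m + 1)) = Fin.succ ⟨k, by omega⟩ := by
        ext; simp
      simp only [e, Fin.cons_succ, Fin.mk_zero, Fin.cons_zero]
      have := fun x s' => M.expect_episodeFrom_apply π m (t + 1) s' ⟨k, by omega⟩
        (fun p => g x p.2.1)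
      simp only at this
      simp_rw [this]
      simp [stateFrom]
    | succ i =>
      have e : (⟨i + 1 + (k + 1), h⟩ : Fin (m + 1)) = Fin.succ ⟨i + (k + 1), by omega⟩ := by
        ext; simp; omega
      have e' : (⟨i + 1, by omega⟩ : Fin (m + 1)) = Fin.succ ⟨i, by omega⟩ := by
        ext; simp
      simp only [e, e', Fin.cons_succ]
      rw [stateFrom, PMF.expect_bind, expect_step]
      simp_rw [ih]
      have e2 : t + 1 + i = t + (i + 1) := by omega
      simp_rw [e2]

lemma stateLaw_eq (M : BlockMDP X S A) (π : ObsPolicy X A) (h : ℕ) :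
    M.stateLaw π h = M.init.bind (M.stateFrom π h 0) := by
  refine PMF.ext_expect fun g => ?_
  rw [stateLaw, PMF.expect_map, episode, PMF.expect_bind, PMF.expect_bind]
  have := fun s => M.expect_episodeFrom_apply π (h + 1) 0 s (Fin.last h) (fun p => g p.1)
  simp only at this
  simp_rw [this]
  simp

lemma obsLaw_eq (M : BlockMDP X S A) (π : ObsPolicy X A) (h : ℕ) :
    M.obsLaw π h = (M.stateLaw π h).bind M.emit := by
  refine PMF.ext_expect fun g => ?_
  rw [stateLaw_eq, obsLaw, PMF.expect_map, episode, PMF.expect_bind, PMF.expect_bind,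
    PMF.expect_bind]
  have := fun s => M.expect_episodeFrom_apply π (h + 1) 0 s (Fin.last h) (fun p => g p.2.1)
  simp only at this
  simp_rw [this]
  simp

lemma stateLaw_succ (M : BlockMDP X S A) (π : ObsPolicy X A) (h : ℕ) :
    M.stateLaw π (h + 1) = (M.stateLaw π h).bind (M.step π h) := by
  rw [stateLaw_eq, stateLaw_eq, funext (M.stateFrom_succ π h 0), PMF.bind_bind, zero_add]

/-- The latent states that can be reached at a given time. -/
def reach (M : BlockMDP X S A) : ℕ → Set S
  | 0 => M.init.support
  | h + 1 => {s' | ∃ s ∈ M.reach h, ∃ a, s' ∈ (M.trans s a).support}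

/-- The uniform policy gives every action positive probability, so one policy witnesses all
reachable states. -/
lemma reach_subset_support [Fintype A] [Nonempty A] (M : BlockMDP X S A) (h : ℕ) :
    M.reach h ⊆ (M.stateLaw (fun _ _ => PMF.uniformOfFintype A) h).support := by
  induction h with
  | zero => simp [stateLaw_eq, stateFrom, reach]
  | succ h ih =>
    rintro s' ⟨s, hs, a, ha⟩
    rw [stateLaw_succ, PMF.mem_support_bind_iff]
    refine ⟨s, ih hs, ?_⟩
    rw [step, PMF.mem_support_bind_iff]
    obtain ⟨x, hx⟩ := (M.emit s).support_nonempty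
    refine ⟨x, hx, ?_⟩
    rw [PMF.mem_support_bind_iff]
    exact ⟨a, PMF.mem_support_uniformOfFintype a, ha⟩

lemma reach_subset_visited [Fintype A] [Nonempty A] (M : BlockMDP X S A) {h H : ℕ} (hH : h < H) :
    M.reach h ⊆ M.visited H := fun _ hs =>
  ⟨h, hH, _, pos_iff_ne_zero.2 ((PMF.mem_support_iff _ _).1 (M.reach_subset_support h hs))⟩

lemma emit_eq_zero (M : BlockMDP X S A) {s : S} {x : X} (h : M.dec x ≠ s) : M.emit s x = 0 := by
  by_contra hx
  exact h (M.dec_of_mem_support s x ((PMF.mem_support_iff _ _).2 hx))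

/-- Disjointness of the emission supports: only the state `M.dec x` can emit `x`. -/
lemma expect_mul_emit (M : BlockMDP X S A) (p : PMF S) (x : X) (c : S → ℝ≥0∞) :
    (p.expect fun s => M.emit s x * c s) = p (M.dec x) * (M.emit (M.dec x) x * c (M.dec x)) := by
  unfold PMF.expect
  rw [tsum_eq_single (M.dec x)]
  intro s hs
  simp [M.emit_eq_zero (s := s) (x := x) hs.symm]

lemma mem_support_obsLaw (M : BlockMDP X S A) {π : ObsPolicy X A} {h : ℕ} {s : S} {x : X}
    (hs : M.stateLaw π h s ≠ 0) (hx : M.emit s x ≠ 0) : x ∈ (M.obsLaw π h).support := by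
  rw [obsLaw_eq, PMF.mem_support_bind_iff]
  exact ⟨s, (PMF.mem_support_iff _ _).2 hs, (PMF.mem_support_iff _ _).2 hx⟩

/-- Law of the state occupied at a uniformly drawn time by the data. -/
def occupancy (M : BlockMDP X S A) (Θ : PMF (ObsPolicy X A)) (H : ℕ) [NeZero H] : PMF S :=
  Θ.bind fun π => (PMF.uniformOfFintype (Fin H)).bind fun h => M.stateLaw π h

lemma multistepLaw_apply (M : BlockMDP X S A) (Θ : PMF (ObsPolicy X A)) (H K : ℕ) [NeZero H]
    (ω : PMF (Fin K)) (x : X) (k : Fin K) (x' : X) :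
    M.multistepLaw Θ H K ω (x, k, x') =
      Θ.expect fun π => (PMF.uniformOfFintype (Fin H)).expect fun h =>
        ω k * (M.stateLaw π h (M.dec x) * (M.emit (M.dec x) x *
          (π h x).expect fun a => (M.trans (M.dec x) a).expect fun s'' =>
            (M.stateFrom π k (h + 1) s'').expect fun z => M.emit z x')) := by
  classical
  have h0 := (M.multistepLaw Θ H K ω).expect_single (x, k, x') (fun _ => 1)
  rw [mul_one] at h0
  rw [← h0, multistepLaw, PMF.expect_bind, videoLaw, PMF.expect_bind]
  refine PMF.expect_congr fun π _ => ?_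
  rw [PMF.expect_map, episode, PMF.expect_bind]
  simp_rw [PMF.expect_bind, PMF.expect_map]
  simp_rw [PMF.expect_comm _ (PMF.uniformOfFintype (Fin H))]
  refine PMF.expect_congr fun h _ => ?_
  simp_rw [PMF.expect_comm _ ω]
  rw [← ω.expect_single k (fun k' => (M.stateLaw π h (M.dec x) * (M.emit (M.dec x) x *
          (π h x).expect fun a => (M.trans (M.dec x) a).expect fun s'' =>
            (M.stateFrom π k' (h + 1) s'').expect fun z => M.emit z x')))]
  refine PMF.expect_congr fun k' _ => ?_
  have key := fun s => M.expect_episodeFrom_apply_pair π (H + K) 0 s h k'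
    (by have := h.2; have := k'.2; omega)
    (fun y y' => if ((y, k', y') : X × Fin K × X) = (x, k, x') then 1 else 0)
  simp_rw [key, ← PMF.expect_bind, ← stateLaw_eq, zero_add, Prod.mk.injEq]
  by_cases hk : k' = k
  · subst hk
    simp only [true_and, if_true]
    have e1 : ∀ z y, ((M.emit z).expect fun y' => if y = x ∧ y' = x' then (1 : ℝ≥0∞) else 0) =
        if y = x then M.emit z x' else 0 := by
      intro z y
      by_cases hy : y = x
      · simpa [hy] using (M.emit z).expect_single x' (fun _ => 1)
      · simp [hy]
    simp_rw [PMF.expect_bind, e1]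
    rw [← expect_mul_emit (c := fun s => (π h x).expect fun a => (M.trans s a).expect fun s'' =>
            (M.stateFrom π k' (h + 1) s'').expect fun z => M.emit z x')]
    refine PMF.expect_congr fun s _ => ?_
    rw [← (M.emit s).expect_single x fun y => (π h y).expect fun a =>
      (M.trans s a).expect fun s'' => (M.stateFrom π k' (h + 1) s'').expect fun z => M.emit z x']
    refine PMF.expect_congr fun y _ => ?_
    by_cases hy : y = x <;> simp [hy]
  · simp [hk]

/-- Under a noise-free mixture, the multistep law factors through the decoder. -/
lemma exists_multistepLaw_eq (M : BlockMDP X S A) (Θ : PMF (ObsPolicy X A)) (H K : ℕ) [NeZero H]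
    (ω : PMF (Fin K)) (hΘ : M.NoiseFree Θ) :
    ∃ W : S → Fin K → X → ℝ≥0∞, (∀ s k, ∑' x', W s k x' = M.occupancy Θ H s) ∧
      ∀ x k x', M.multistepLaw Θ H K ω (x, k, x') =
        M.emit (M.dec x) x * (ω k * W (M.dec x) k x') := by
  classical
  have : Nonempty (ℕ → S → PMF A) := by
    obtain ⟨π, hπ⟩ := Θ.support_nonempty
    exact ⟨(hΘ π hπ).choose⟩
  choose! σ hσ using hΘ
  -- `W` is the joint mass of the state at the uniform time and the later observation, with `π h x`
  -- replaced by the latent action law `σ π h s`. Summing out `x'` leaves the occupancy, whatever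
  -- the gap.
  refine ⟨fun s k x' => Θ.expect fun π => (PMF.uniformOfFintype (Fin H)).expect fun h =>
      M.stateLaw π h s * ((σ π h s).expect fun a => (M.trans s a).expect fun s'' =>
            (M.stateFrom π k (h + 1) s'').expect fun z => M.emit z x'), ?_, ?_⟩
  · intro s k
    rw [← PMF.expect_tsum]
    simp_rw [← PMF.expect_tsum, ENNReal.tsum_mul_left, ← PMF.expect_tsum, PMF.tsum_coe,
      PMF.expect_const, mul_one]
    rw [← mul_one (M.occupancy Θ H s), ← PMF.expect_single _ s (fun _ => 1), occupancy,
      PMF.expect_bind]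
    simp_rw [PMF.expect_bind, PMF.expect_single, mul_one]
  · intro x k x'
    rw [multistepLaw_apply, ← mul_assoc, ← PMF.expect_const_mul]
    refine PMF.expect_congr fun π hπ => ?_
    rw [← PMF.expect_const_mul]
    refine PMF.expect_congr fun h _ => ?_
    by_cases h1 : M.stateLaw π h (M.dec x) = 0
    · simp [h1]
    by_cases h2 : M.emit (M.dec x) x = 0
    · simp [h2]
    -- Noise-freeness is available only at observations that `π` can meet; at all others both sides
    -- already vanish.
    rw [hσ π hπ h x (M.mem_support_obsLaw h1 h2)]
    ring

/-- Coverage at a single time suffices: the uniform time hits it with probability `1 / H`. -/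
lemma ofReal_div_le_occupancy (M : BlockMDP X S A) {Θ : PMF (ObsPolicy X A)} {H : ℕ} [NeZero H]
    {Pol : Set (ObsPolicy X A)} {η : ℝ} (hc : M.Covers H Pol Θ η) {s : S}
    (hs : s ∈ M.visited H) : ENNReal.ofReal (η / H) ≤ M.occupancy Θ H s := by
  classical
  obtain ⟨h, hH, hπ⟩ := hc.visit s hs
  have := hc.cover h hH s hπ
  rw [occupancy, PMF.bind_comm, PMF.bind_apply]
  refine le_trans ?_ (ENNReal.le_tsum (⟨h, hH⟩ : Fin H))
  have h0 : (0 : ℝ) < H := by exact_mod_cast Nat.pos_of_ne_zero (NeZero.ne H)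
  rw [PMF.uniformOfFintype_apply, div_eq_inv_mul, ENNReal.ofReal_mul (by positivity),
    ENNReal.ofReal_inv_of_pos h0]
  simp only [ENNReal.ofReal_natCast, Fintype.card_fin]
  gcongr

lemma eta_le_one (M : BlockMDP X S A) {Θ : PMF (ObsPolicy X A)} {H : ℕ} [NeZero H]
    {Pol : Set (ObsPolicy X A)} {η : ℝ} (hc : M.Covers H Pol Θ η) {s : S}
    (hs : s ∈ M.visited H) : η ≤ 1 := by
  obtain ⟨h, hH, hπ⟩ := hc.visit s hs
  have := (hc.cover h hH s hπ).trans (PMF.coe_le_one _ s)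
  simpa using this

end BlockMDP

/-! ### Likelihood ratios, Bhattacharyya coefficient and `ℓ¹` distance -/

section Likelihood

variable {Y : Type*}

lemma iidLaw_apply (P : PMF Y) (n : ℕ) (v : Fin n → Y) : iidLaw P n v = ∏ i, P (v i) := by
  classical
  induction n with
  | zero =>
    rw [iidLaw, Subsingleton.elim v Fin.elim0]
    simp
  | succ n ih =>
    have h0 := (iidLaw P (n + 1)).expect_single v (fun _ => 1)
    rw [mul_one] at h0
    rw [← h0, iidLaw, PMF.expect_bind, Fin.prod_univ_succ, ← ih,
      ← PMF.expect_single P (v 0) fun _ => iidLaw P n fun i => v i.succ]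
    refine PMF.expect_congr fun y _ => ?_
    rw [PMF.expect_map]
    have hc : ∀ τ : Fin n → Y, (Fin.cons y τ : Fin (n + 1) → Y) = v ↔
        y = v 0 ∧ τ = fun i => v i.succ := by
      intro τ
      rw [funext_iff, Fin.forall_fin_succ]
      simp [funext_iff]
    simp_rw [hc]
    by_cases hy : y = v 0
    · simpa [hy] using (iidLaw P n).expect_single (fun i => v i.succ) (fun _ => 1)
    · simp [hy]

lemma ENNReal.tsum_pi_prod (g : Y → ℝ≥0∞) (n : ℕ) :
    ∑' v : Fin n → Y, ∏ i, g (v i) = (∑' y, g y) ^ n := by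
  induction n with
  | zero => simp
  | succ n ih =>
    rw [← (Fin.consEquiv fun _ : Fin (n + 1) => Y).tsum_eq,
      ENNReal.tsum_prod (f := fun y v => ∏ i, g ((Fin.consEquiv fun _ : Fin (n + 1) => Y) (y, v) i)),
      pow_succ', ← ih, ← ENNReal.tsum_mul_right]
    refine tsum_congr fun y => ?_
    rw [← ENNReal.tsum_mul_left]
    refine tsum_congr fun v => ?_
    rw [Fin.prod_univ_succ]
    simp [Fin.consEquiv]

/-- The Bhattacharyya coefficient of two laws. -/
def bhattacharyya (P Q : PMF Y) : ℝ≥0∞ := ∑' y, (P y * Q y) ^ (1 / 2 : ℝ)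

/-- The `ℓ¹` distance of two nonnegative functions. -/
def l1Dist (p q : Y → ℝ≥0∞) : ℝ≥0∞ := ∑' y, ((p y - q y) + (q y - p y))

/-- Under `P`, the probability that `Q` has at least the likelihood of `P` on `n` samples. -/
lemma iidLaw_likelihood_le (P Q : PMF Y) (n : ℕ) :
    (iidLaw P n).toOuterMeasure {v | ∏ i, P (v i) ≤ ∏ i, Q (v i)} ≤ bhattacharyya P Q ^ n := by
  rw [PMF.toOuterMeasure_apply, bhattacharyya, ← ENNReal.tsum_pi_prod]
  refine ENNReal.tsum_le_tsum fun v => ?_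
  rw [Set.indicator_apply]
  split_ifs with hv
  swap
  · exact zero_le
  rw [iidLaw_apply]
  rw [ ENNReal.prod_rpow_of_nonneg (by norm_num), Finset.prod_mul_distrib]
  -- On the event, the likelihood of `P` is at most the geometric mean of the two likelihoods, whose
  -- sum over samples factors into a power.
  calc ∏ i, P (v i) = ((∏ i, P (v i)) * ∏ i, P (v i)) ^ (1 / 2 : ℝ) := by
        rw [← sq, ← ENNReal.rpow_natCast, ← ENNReal.rpow_mul]
        norm_num
    _ ≤ _ := ENNReal.rpow_le_rpow (mul_le_mul_right hv _) (by norm_num)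

/-- With `a = √p` and `b = √q`, split `(a + b)|a - b|` by AM-GM with weight `c`. This linearizes the
Cauchy–Schwarz comparison of `ℓ¹` and Hellinger distances, so that it can be summed term by term. -/
lemma abs_sub_add_sqrt_le {p q c : ℝ} (hp : 0 ≤ p) (hq : 0 ≤ q) (hc : 0 < c) :
    |p - q| + c * √(p * q) ≤ c * ((p + q) / 2) + (p + q) / c := by
  obtain ⟨a, ha, rfl⟩ : ∃ a, 0 ≤ a ∧ a ^ 2 = p := ⟨√p, Real.sqrt_nonneg _, Real.sq_sqrt hp⟩
  obtain ⟨b, hb, rfl⟩ : ∃ b, 0 ≤ b ∧ b ^ 2 = q := ⟨√q, Real.sqrt_nonneg _, Real.sq_sqrt hq⟩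
  rw [← mul_pow, Real.sqrt_sq (by positivity), sq_sub_sq, abs_mul, abs_of_nonneg (add_nonneg ha hb)]
  have h1 : (a + b) ^ 2 / (2 * c) ≤ (a ^ 2 + b ^ 2) / c := by
    rw [div_le_div_iff₀ (by positivity) hc]
    nlinarith [sq_nonneg (a - b)]
  have h2 : (a + b) * |a - b| ≤ c * |a - b| ^ 2 / 2 + (a + b) ^ 2 / (2 * c) := by
    rw [← sub_nonneg]
    have : c * |a - b| ^ 2 / 2 + (a + b) ^ 2 / (2 * c) - (a + b) * |a - b| =
        (c * |a - b| - (a + b)) ^ 2 / (2 * c) := by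
      field_simp
      ring
    rw [this]
    positivity
  rw [sq_abs] at h2
  linarith

lemma l1Dist_add_bhattacharyya_le (P Q : PMF Y) {c : ℝ} (hc : 0 < c) :
    l1Dist P Q + ENNReal.ofReal c * bhattacharyya P Q ≤ ENNReal.ofReal (c + 2 / c) := by
  have e : ENNReal.ofReal (c + 2 / c) = ∑' y, (ENNReal.ofReal (c / 2 + 1 / c) * (P y + Q y)) := by
    rw [ENNReal.tsum_mul_left, ENNReal.tsum_add, P.tsum_coe, Q.tsum_coe, one_add_one_eq_two,
      ← ENNReal.ofReal_ofNat 2, ← ENNReal.ofReal_mul (by positivity)]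
    congr 1
    ring
  rw [e, l1Dist, bhattacharyya, ← ENNReal.tsum_mul_left, ← ENNReal.tsum_add]
  refine ENNReal.tsum_le_tsum fun y => ?_
  obtain ⟨p, hp, hp'⟩ : ∃ p : ℝ, 0 ≤ p ∧ ENNReal.ofReal p = P y :=
    ⟨_, ENNReal.toReal_nonneg, ENNReal.ofReal_toReal (P.apply_ne_top y)⟩
  obtain ⟨q, hq, hq'⟩ : ∃ q : ℝ, 0 ≤ q ∧ ENNReal.ofReal q = Q y :=
    ⟨_, ENNReal.toReal_nonneg, ENNReal.ofReal_toReal (Q.apply_ne_top y)⟩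
  rw [← hp', ← hq', ← ENNReal.ofReal_mul hp, ENNReal.ofReal_rpow_of_nonneg (by positivity)
    (by norm_num), ← Real.sqrt_eq_rpow, ← ENNReal.ofReal_sub _ hq, ← ENNReal.ofReal_sub _ hp,
    ← ENNReal.ofReal_add hp hq, ← ENNReal.ofReal_mul (by positivity),
    ← ENNReal.ofReal_mul (by positivity)]
  have h1 : ENNReal.ofReal (p - q) + ENNReal.ofReal (q - p) = ENNReal.ofReal |p - q| := by
    rcases le_total p q with h | h
    · rw [ENNReal.ofReal_of_nonpos (by linarith : p - q ≤ 0), abs_sub_comm,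
        abs_of_nonneg (by linarith : 0 ≤ q - p), zero_add]
    · rw [ENNReal.ofReal_of_nonpos (by linarith : q - p ≤ 0),
        abs_of_nonneg (by linarith : 0 ≤ p - q), add_zero]
  rw [h1, ← ENNReal.ofReal_add (abs_nonneg _) (by positivity)]
  refine ENNReal.ofReal_le_ofReal ((abs_sub_add_sqrt_le hp hq hc).trans_eq ?_)
  ring

lemma l1Dist_le_of_bhattacharyya (P Q : PMF Y) {u : ℝ} (hu : 0 < u)
    (h : ENNReal.ofReal (1 - u) ≤ bhattacharyya P Q) :
    l1Dist P Q ≤ ENNReal.ofReal (2 * √(2 * u)) := by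
  -- This `c` minimizes the resulting bound `c u + 2 / c`, making both terms `√(2u)`.
  set c := 2 / √(2 * u) with hc
  have h2 : 0 < √(2 * u) := by positivity
  have hs : √(2 * u) * √(2 * u) = 2 * u := Real.mul_self_sqrt (by positivity)
  have hc0 : 0 < c := by positivity
  have hb := l1Dist_add_bhattacharyya_le P Q hc0
  have hb2 : l1Dist P Q + ENNReal.ofReal (c * (1 - u)) ≤ ENNReal.ofReal (c + 2 / c) := by
    refine le_trans ?_ hb
    rw [ENNReal.ofReal_mul hc0.le]
    gcongr
  have hne : l1Dist P Q ≠ ⊤ := ne_top_of_le_ne_top ENNReal.ofReal_ne_top (le_self_add.trans hb2)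
  rw [← ENNReal.ofReal_toReal hne] at hb2 ⊢
  refine ENNReal.ofReal_le_ofReal ?_
  have h3 : (l1Dist P Q).toReal + c * (1 - u) ≤ c + 2 / c := by
    by_cases hu1 : 0 ≤ 1 - u
    · rwa [← ENNReal.ofReal_add ENNReal.toReal_nonneg (by positivity),
        ENNReal.ofReal_le_ofReal_iff (by positivity)] at hb2
    · have h4 : (l1Dist P Q).toReal ≤ c + 2 / c :=
        (ENNReal.ofReal_le_ofReal_iff (by positivity)).1 (le_self_add.trans hb2)
      have : c * (1 - u) ≤ 0 := mul_nonpos_of_nonneg_of_nonpos hc0.le (by linarith)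
      linarith
  have h5 : c * u = √(2 * u) := by
    rw [hc]; field_simp; nlinarith
  have h6 : 2 / c = √(2 * u) := by
    rw [hc]; field_simp
  nlinarith

end Likelihood

/-! ### The maximum likelihood estimate -/

section ForwardModeling

variable {X : Type*} {N K n : ℕ}

/-- The law with the same first two coordinates as `P` in which the last one is drawn from the
model `f` applied to the decoded observation. -/
def modelLaw (P : PMF (X × Fin K × X)) (f : Fin N → Fin K → PMF X) (φ : X → Fin N) :
    PMF (X × Fin K × X) :=
  P.bind fun p => (f (φ p.1) p.2.1).map fun x' => (p.1, p.2.1, x')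

lemma modelLaw_apply (P : PMF (X × Fin K × X)) (f : Fin N → Fin K → PMF X) (φ : X → Fin N)
    (x : X) (k : Fin K) (x' : X) :
    modelLaw P f φ (x, k, x') =
      P.toOuterMeasure {p | p.1 = x ∧ p.2.1 = k} * f (φ x) k x' := by
  classical
  have h0 := (modelLaw P f φ).expect_single (x, k, x') (fun _ => 1)
  rw [mul_one] at h0
  rw [← h0, modelLaw, PMF.expect_bind, PMF.toOuterMeasure_eq_expect, mul_comm,
    ← PMF.expect_const_mul]
  refine PMF.expect_congr fun p _ => ?_
  rw [PMF.expect_map]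
  simp_rw [Prod.mk.injEq]
  by_cases h : p.1 = x ∧ p.2.1 = k
  · obtain ⟨rfl, rfl⟩ := h
    simpa using (f (φ p.1) p.2.1).expect_single x' (fun _ => 1)
  · have : ∀ y, ¬ (p.1 = x ∧ p.2.1 = k ∧ y = x') := fun y hy => h ⟨hy.1, hy.2.1⟩
    simp [this, h]

lemma modelLaw_eq_self {P : PMF (X × Fin K × X)} {f : Fin N → Fin K → PMF X} {φ : X → Fin N}
    (h : ∀ x k, 0 < P.toOuterMeasure {p | p.1 = x ∧ p.2.1 = k} →
      ∀ x', f (φ x) k x' = condObs P x k x') : modelLaw P f φ = P := by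
  ext ⟨x, k, x'⟩
  rw [modelLaw_apply]
  rcases (zero_le (a := P.toOuterMeasure {p | p.1 = x ∧ p.2.1 = k})).eq_or_lt with h0 | h0
  · rw [← h0, zero_mul, eq_comm]
    have : P.toOuterMeasure {(x, k, x')} ≤ P.toOuterMeasure {p | p.1 = x ∧ p.2.1 = k} :=
      P.toOuterMeasure.mono (by simp)
    rw [← h0, PMF.toOuterMeasure_apply_singleton] at this
    exact le_antisymm this zero_le
  · rw [h x k h0, condObs, ENNReal.mul_div_cancel h0.ne']
    exact ne_top_of_le_ne_top ENNReal.one_ne_top (P.toOuterMeasure_le_one _)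

lemma ENNReal.sum_log {ι : Type*} (s : Finset ι) (g : ι → ℝ≥0∞) :
    ∑ i ∈ s, ENNReal.log (g i) = ENNReal.log (∏ i ∈ s, g i) := by
  classical
  induction s using Finset.induction_on with
  | empty => simp
  | insert a s ha ih => rw [Finset.sum_insert ha, Finset.prod_insert ha, ih, ENNReal.log_mul_add]

/-- All model laws share the `(x, k)` marginal of `P`, so comparing conditional likelihoods compares
joint ones. -/
lemma prod_modelLaw_le {P : PMF (X × Fin K × X)} {data : Fin n → X × Fin K × X}
    {f g : Fin N → Fin K → PMF X} {φ ψ : X → Fin N}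
    (h : logLikelihood data f φ ≤ logLikelihood data g ψ) :
    ∏ i, modelLaw P f φ (data i) ≤ ∏ i, modelLaw P g ψ (data i) := by
  rw [logLikelihood, logLikelihood, ENNReal.sum_log, ENNReal.sum_log, ENNReal.log_le_log_iff] at h
  have e : ∀ (f : Fin N → Fin K → PMF X) (φ : X → Fin N) (i : Fin n),
      modelLaw P f φ (data i) = P.toOuterMeasure {p | p.1 = (data i).1 ∧ p.2.1 = (data i).2.1} *
        f (φ (data i).1) (data i).2.1 (data i).2.2 := fun f φ i => modelLaw_apply P f φ _ _ _
  simp_rw [e, Finset.prod_mul_distrib]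
  gcongr

/-- The maximum likelihood estimate is close to the truth in total variation. -/
lemma iidLaw_mle_le (P : PMF (X × Fin K × X)) {F : Finset (Fin N → Fin K → PMF X)}
    {Φ : Finset (X → Fin N)} (hr : Realizable P F Φ) {δ : ℝ} (hδ : 0 < δ) (hδ1 : δ < 1)
    (hn : 0 < n) (est : (Fin n → X × Fin K × X) → (Fin N → Fin K → PMF X) × (X → Fin N))
    (hest : ∀ data, IsMaxLikelihood F Φ data (est data)) :
    (iidLaw P n).toOuterMeasure {data | ¬ l1Dist P (modelLaw P (est data).1 (est data).2) ≤
      ENNReal.ofReal (2 * √(6 * (1 / n * Real.log (F.card * Φ.card / δ))))} ≤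
        ENNReal.ofReal (δ / 4) := by
  classical
  obtain ⟨f, hf, φ, hφ, hfφ⟩ := hr
  have hP := modelLaw_eq_self hfφ
  have hn' : (0 : ℝ) < n := by exact_mod_cast hn
  set m := F.card * Φ.card with hm
  have hmpos : 0 < m := Nat.mul_pos (Finset.card_pos.2 ⟨f, hf⟩) (Finset.card_pos.2 ⟨φ, hφ⟩)
  have hmr : (F.card : ℝ) * Φ.card = m := by rw [hm]; push_cast; ring
  rw [hmr]
  -- A single candidate is the truth itself. Two or more give `ln 2 ≤ L`, which absorbs the extra
  -- `4` in `ln(4m/δ) ≤ 3L`.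
  rcases Nat.lt_or_ge 1 m with h1 | h1
  swap
  · have hm1 : m = 1 := le_antisymm h1 hmpos
    rw [hm, mul_eq_one] at hm1
    have : ∀ data, est data = (f, φ) := by
      intro data
      obtain ⟨h1, h2, -⟩ := hest data
      exact Prod.ext (Finset.card_le_one.1 hm1.1.le _ h1 _ hf)
        (Finset.card_le_one.1 hm1.2.le _ h2 _ hφ)
    simp [this, hP, l1Dist]
  have hm2 : (2 : ℝ) ≤ m := by exact_mod_cast h1
  set L := Real.log (m / δ) with hL
  have hL2 : Real.log 2 ≤ L := by
    refine Real.log_le_log (by norm_num) ?_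
    rw [le_div_iff₀ hδ]
    nlinarith
  have hlog2 : 0 < Real.log 2 := Real.log_pos (by norm_num)
  set L' := Real.log (4 * (m / δ)) with hL'
  have hpos : 0 < 4 * (m / δ) := by positivity
  have hLL : L' ≤ 3 * L := by
    rw [hL', Real.log_mul (by norm_num) (by positivity), ← hL]
    have : Real.log 4 = 2 * Real.log 2 := by
      rw [show (4 : ℝ) = 2 ^ 2 by norm_num, Real.log_pow]; norm_num
    linarith
  have hL'0 : 0 < L' := by
    refine Real.log_pos ?_
    have : 1 ≤ m / δ := by rw [le_div_iff₀ hδ]; linarith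
    linarith
  set bad : Finset ((Fin N → Fin K → PMF X) × (X → Fin N)) :=
    (F ×ˢ Φ).filter fun e => bhattacharyya P (modelLaw P e.1 e.2) ≤
      ENNReal.ofReal (Real.exp (-(L' / n))) with hbad
  calc _ ≤ (iidLaw P n).toOuterMeasure (⋃ e ∈ bad,
          {v | ∏ i, P (v i) ≤ ∏ i, modelLaw P e.1 e.2 (v i)}) := by
        refine (iidLaw P n).toOuterMeasure.mono fun data hdata => ?_
        obtain ⟨h1, h2, h3⟩ := hest data
        simp only [Set.mem_iUnion]
        refine ⟨est data, ?_, ?_⟩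
        · rw [hbad, Finset.mem_filter, Finset.mem_product]
          refine ⟨⟨h1, h2⟩, ?_⟩
          by_contra hlt
          refine hdata ?_
          have hu : 0 < L' / n := by positivity
          refine (l1Dist_le_of_bhattacharyya _ _ hu ?_).trans ?_
          · refine le_trans (ENNReal.ofReal_le_ofReal ?_) (not_le.1 hlt).le
            linarith [Real.add_one_le_exp (-(L' / n))]
          · refine ENNReal.ofReal_le_ofReal ?_
            refine mul_le_mul_of_nonneg_left (Real.sqrt_le_sqrt ?_) zero_le_two
            rw [div_eq_inv_mul, one_div]
            have := mul_le_mul_of_nonneg_left hLL (inv_nonneg.2 hn'.le)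
            linarith
        · have := prod_modelLaw_le (P := P) (h3 f hf φ hφ)
          rwa [hP] at this
    _ ≤ ∑ e ∈ bad, (iidLaw P n).toOuterMeasure
          {v | ∏ i, P (v i) ≤ ∏ i, modelLaw P e.1 e.2 (v i)} :=
        MeasureTheory.measure_biUnion_finset_le _ _
    _ ≤ ∑ e ∈ bad, ENNReal.ofReal (δ / 4 / m) := by
        refine Finset.sum_le_sum fun e he => ?_
        refine (iidLaw_likelihood_le _ _ _).trans ?_
        refine (pow_le_pow_left₀ zero_le (Finset.mem_filter.1 he).2 n).trans ?_
        rw [← ENNReal.ofReal_pow (Real.exp_pos _).le, ← Real.exp_nat_mul]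
        refine ENNReal.ofReal_le_ofReal (le_of_eq ?_)
        rw [mul_neg, mul_div_cancel₀ _ hn'.ne', Real.exp_neg, hL', Real.exp_log hpos]
        field_simp
    _ ≤ (m : ℝ≥0∞) * ENNReal.ofReal (δ / 4 / m) := by
        rw [Finset.sum_const, nsmul_eq_mul]
        gcongr
        exact (Finset.card_filter_le _ _).trans_eq (Finset.card_product _ _)
    _ = ENNReal.ofReal (δ / 4) := by
        rw [← ENNReal.ofReal_natCast, ← ENNReal.ofReal_mul (by positivity)]
        congr 1
        field_simp

end ForwardModeling

/-! ### `ℓ¹` and total variation distance -/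

section Distance

variable {Y : Type*}

lemma l1Dist_comm (p q : Y → ℝ≥0∞) : l1Dist p q = l1Dist q p :=
  tsum_congr fun _ => add_comm _ _

lemma l1Dist_triangle (p q r : Y → ℝ≥0∞) : l1Dist p r ≤ l1Dist p q + l1Dist q r := by
  rw [l1Dist, l1Dist, l1Dist, ← ENNReal.tsum_add]
  refine ENNReal.tsum_le_tsum fun y => ?_
  calc (p y - r y) + (r y - p y)
      ≤ ((p y - q y) + (q y - r y)) + ((r y - q y) + (q y - p y)) :=
        add_le_add tsub_le_tsub_add_tsub tsub_le_tsub_add_tsub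
    _ = _ := by ring

lemma ofReal_abs_toReal_sub_le (a b : ℝ≥0∞) :
    ENNReal.ofReal |a.toReal - b.toReal| ≤ (a - b) + (b - a) := by
  rcases eq_or_ne a ⊤ with rfl | ha
  · rcases eq_or_ne b ⊤ with rfl | hb
    · simp
    · simp [ENNReal.top_sub hb]
  rcases eq_or_ne b ⊤ with rfl | hb
  · simp [ENNReal.top_sub ha]
  rcases le_total a b with h | h
  · rw [abs_sub_comm, ← ENNReal.toReal_sub_of_le h hb, abs_of_nonneg ENNReal.toReal_nonneg,
      ENNReal.ofReal_toReal (ENNReal.sub_ne_top hb)]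
    exact le_add_self
  · rw [← ENNReal.toReal_sub_of_le h ha, abs_of_nonneg ENNReal.toReal_nonneg,
      ENNReal.ofReal_toReal (ENNReal.sub_ne_top ha)]
    exact le_self_add

lemma ofReal_two_mul_tvDist_le (p q : Y → ℝ≥0∞) :
    ENNReal.ofReal (2 * tvDist p q) ≤ l1Dist p q := by
  rw [tvDist, ← mul_assoc, mul_one_div_cancel two_ne_zero, one_mul]
  -- A divergent real series has sum `0` by convention, which makes the bound trivial.
  by_cases h : Summable fun x => |(p x).toReal - (q x).toReal|
  · rw [ENNReal.ofReal_tsum_of_nonneg (fun _ => abs_nonneg _) h]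
    exact ENNReal.tsum_le_tsum fun y => ofReal_abs_toReal_sub_le _ _
  · simp [tsum_eq_zero_of_not_summable h]

lemma tvDist_nonneg (p q : Y → ℝ≥0∞) : 0 ≤ tvDist p q :=
  mul_nonneg (by norm_num) (tsum_nonneg fun _ => abs_nonneg _)

lemma PMF.expect_fintype {α : Type*} [Fintype α] (p : PMF α) (g : α → ℝ≥0∞) :
    p.expect g = ∑ a, p a * g a := tsum_fintype _

lemma ForwardMargin.ofReal_le {X S : Type*} {K : ℕ} {P : PMF (X × Fin K × X)} {dec : X → S}
    {ω : PMF (Fin K)} {V : Set S} {β : ℝ} (h : ForwardMargin P dec ω V β)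
    {s₁ s₂ : S} (h₁ : s₁ ∈ V) (h₂ : s₂ ∈ V) (hne : s₁ ≠ s₂) :
    ENNReal.ofReal (2 * β) ≤
      ω.expect fun k => l1Dist (condState P dec s₁ k) (condState P dec s₂ k) := by
  have h0 : 2 * β ≤ ∑ k, (ω k).toReal *
      (2 * tvDist (condState P dec s₁ k) (condState P dec s₂ k)) := by
    refine (mul_le_mul_of_nonneg_left (h s₁ h₁ s₂ h₂ hne) zero_le_two).trans_eq ?_
    rw [Finset.mul_sum]
    exact Finset.sum_congr rfl fun k _ => by ring
  refine (ENNReal.ofReal_le_ofReal h0).trans ?_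
  rw [PMF.expect_fintype, ENNReal.ofReal_sum_of_nonneg fun k _ =>
    mul_nonneg ENNReal.toReal_nonneg (mul_nonneg zero_le_two (tvDist_nonneg _ _))]
  refine Finset.sum_le_sum fun k _ => ?_
  rw [ENNReal.ofReal_mul ENNReal.toReal_nonneg, ENNReal.ofReal_toReal (ω.apply_ne_top k)]
  exact mul_le_mul_right (ofReal_two_mul_tvDist_le _ _) _

end Distance

/-! ### From a close model to a bijective decoding -/

namespace BlockMDP

variable {X S A : Type*} {K N : ℕ}

lemma tsum_emit_ite [DecidableEq S] (M : BlockMDP X S A) (s : S) :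
    ∑' x, (if M.dec x = s then M.emit (M.dec x) x else 0) = 1 := by
  rw [← (M.emit s).tsum_coe]
  refine tsum_congr fun x => ?_
  split_ifs with h
  · rw [h]
  · rw [M.emit_eq_zero h]

/-- The expectation under a law on multistep transitions, as an iterated sum. -/
lemma expect_triple (P : PMF (X × Fin K × X)) (g : X × Fin K × X → ℝ≥0∞) :
    P.expect g = ∑' x, ∑' k, ∑' x', P (x, k, x') * g (x, k, x') := by
  rw [PMF.expect, ENNReal.tsum_prod']
  exact tsum_congr fun x => ENNReal.tsum_prod'

section Factored

variable (M : BlockMDP X S A) (P : PMF (X × Fin K × X)) (ω : PMF (Fin K))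
  (W : S → Fin K → X → ℝ≥0∞)
  (hP : ∀ x k x', P (x, k, x') = M.emit (M.dec x) x * (ω k * W (M.dec x) k x'))

include hP

lemma toOuterMeasure_obs_gap (x : X) (k : Fin K) :
    P.toOuterMeasure {p | p.1 = x ∧ p.2.1 = k} =
      M.emit (M.dec x) x * (ω k * ∑' x', W (M.dec x) k x') := by
  classical
  rw [PMF.toOuterMeasure_eq_expect, expect_triple, tsum_eq_single x, tsum_eq_single k]
  · simp [hP, ENNReal.tsum_mul_left]
  · intro b hb
    simp [hb]
  · intro b hb
    simp [hb]

lemma toOuterMeasure_state_gap (s : S) (k : Fin K) :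
    P.toOuterMeasure {p | M.dec p.1 = s ∧ p.2.1 = k} = ω k * ∑' x', W s k x' := by
  classical
  rw [PMF.toOuterMeasure_eq_expect, expect_triple, ← one_mul (ω k * _), ← M.tsum_emit_ite s,
    ← ENNReal.tsum_mul_right]
  refine tsum_congr fun x => ?_
  rw [tsum_eq_single k]
  · by_cases h : M.dec x = s
    · simp [hP, h, ENNReal.tsum_mul_left]
    · simp [h]
  · intro b hb
    simp [hb]

lemma toOuterMeasure_state_gap_obs (s : S) (k : Fin K) (x' : X) :
    P.toOuterMeasure {p | M.dec p.1 = s ∧ p.2.1 = k ∧ p.2.2 = x'} = ω k * W s k x' := by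
  classical
  rw [PMF.toOuterMeasure_eq_expect, expect_triple, ← one_mul (ω k * _), ← M.tsum_emit_ite s,
    ← ENNReal.tsum_mul_right]
  refine tsum_congr fun x => ?_
  rw [tsum_eq_single k, tsum_eq_single x']
  · by_cases h : M.dec x = s
    · simp [hP, h]
    · simp [h]
  · intro b hb
    simp [hb]
  · intro b hb
    simp [hb]

/-- Where `M.dec x = s`, the data law and the model law share the factor `q(x ∣ s) ω(k) ρ(s)`; what
remains is the difference of the conditional laws. The other `x` only add to the right-hand side. -/
lemma mul_expect_l1Dist_le {ρ : S → ℝ≥0∞} (hW : ∀ s k, ∑' x', W s k x' = ρ s)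
    (hρ : ∀ s, ρ s ≠ ⊤) (f : Fin N → Fin K → PMF X) (φ : X → Fin N) {s : S} (hs : ρ s ≠ 0) :
    ρ s * ((M.emit s).expect fun x => ω.expect fun k =>
      l1Dist (condState P M.dec s k) (f (φ x) k)) ≤ l1Dist P (modelLaw P f φ) := by
  rw [l1Dist, ENNReal.tsum_prod', PMF.expect, ← ENNReal.tsum_mul_left]
  refine ENNReal.tsum_le_tsum fun x => ?_
  rw [ENNReal.tsum_prod', PMF.expect, ← ENNReal.tsum_mul_left, ← ENNReal.tsum_mul_left]
  refine ENNReal.tsum_le_tsum fun k => ?_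
  rw [l1Dist, ← ENNReal.tsum_mul_left, ← ENNReal.tsum_mul_left, ← ENNReal.tsum_mul_left]
  refine ENNReal.tsum_le_tsum fun x' => ?_
  by_cases h1 : M.dec x = s
  swap
  · simp [M.emit_eq_zero h1]
  subst h1
  by_cases h2 : ω k = 0
  · simp [h2]
  have e : ρ (M.dec x) * condState P M.dec (M.dec x) k x' = W (M.dec x) k x' := by
    rw [condState, M.toOuterMeasure_state_gap_obs P ω W hP, M.toOuterMeasure_state_gap P ω W hP,
      hW, ENNReal.mul_div_mul_left _ _ h2 (ω.apply_ne_top k), ENNReal.mul_div_cancel hs (hρ _)]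
  have hmul : ∀ a b : ℝ≥0∞, ρ (M.dec x) * (M.emit (M.dec x) x * (ω k * (a - b))) =
      M.emit (M.dec x) x * (ω k * (ρ (M.dec x) * a)) -
        M.emit (M.dec x) x * (ω k * (ρ (M.dec x) * b)) := by
    intro a b
    rw [← ENNReal.mul_sub fun _ _ => (M.emit _).apply_ne_top x,
      ← ENNReal.mul_sub fun _ _ => ω.apply_ne_top k, ← ENNReal.mul_sub fun _ _ => hρ _]
    ring
  rw [mul_add, mul_add, mul_add, hmul, hmul, e, hP, modelLaw_apply,
    M.toOuterMeasure_obs_gap P ω W hP, hW]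
  simp only [mul_assoc, le_refl]

/-- A model that is close to the data law decodes the states in `V` up to a relabelling. -/
lemma exists_decoding [Finite S] {ρ : S → ℝ≥0∞} (hW : ∀ s k, ∑' x', W s k x' = ρ s)
    (hρ : ∀ s, ρ s ≠ ⊤) {V : Set S} (hN : N = Nat.card V) {r β : ℝ} (hr : 0 < r) (hβ : 0 < β)
    (hV : ∀ s ∈ V, ENNReal.ofReal r ≤ ρ s) (hm : ForwardMargin P M.dec ω V β)
    (f : Fin N → Fin K → PMF X) (φ : X → Fin N) {e : ℝ} (he : e < r * β)
    (hd : l1Dist P (modelLaw P f φ) ≤ ENNReal.ofReal e) :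
    ∃ α : V ≃ Fin N, ∀ s : V,
      ENNReal.ofReal (r * β) * (M.emit s).toOuterMeasure {x | φ x ≠ α s} ≤ ENNReal.ofReal e := by
  set d : S → Fin N → ℝ≥0∞ := fun s i =>
    ω.expect fun k => l1Dist (condState P M.dec s k) (f i k) with hdd
  have hrβ : 0 < r * β := mul_pos hr hβ
  have key : ∀ s ∈ V, ENNReal.ofReal r * ((M.emit s).expect fun x => d s (φ x)) ≤
      ENNReal.ofReal e := by
    intro s hs
    have h0 : ρ s ≠ 0 := ((ENNReal.ofReal_pos.2 hr).trans_le (hV s hs)).ne'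
    exact (mul_le_mul_left (hV s hs) _).trans
      ((M.mul_expect_l1Dist_le P ω W hP hW hρ f φ h0).trans hd)
  -- If every label were at distance at least `β` from `s`, the mean would be too, contradicting `e
  -- < r * β`.
  have hex : ∀ s : V, ∃ i, d s i < ENNReal.ofReal β := by
    intro s
    by_contra! hcon
    have h1 : ENNReal.ofReal (r * β) ≤ ENNReal.ofReal e := by
      rw [ENNReal.ofReal_mul hr.le]
      refine le_trans ?_ (key s s.2)
      gcongr
      rw [← (M.emit s).expect_const (ENNReal.ofReal β)]
      exact PMF.expect_mono fun x _ => hcon _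
    exact absurd h1 (not_le.2 ((ENNReal.ofReal_lt_ofReal_iff hrβ).2 he))
  choose a ha using hex
  have hsep : ∀ s₁ ∈ V, ∀ s₂ ∈ V, s₁ ≠ s₂ → ∀ i,
      ENNReal.ofReal β + ENNReal.ofReal β ≤ d s₁ i + d s₂ i := by
    intro s₁ h₁ s₂ h₂ hne i
    rw [← ENNReal.ofReal_add hβ.le hβ.le, ← two_mul]
    refine (hm.ofReal_le h₁ h₂ hne).trans ?_
    rw [hdd, ← PMF.expect_add]
    refine PMF.expect_mono fun k _ => ?_
    rw [l1Dist_comm (condState P M.dec s₂ k)]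
    exact l1Dist_triangle _ _ _
  have hinj : Function.Injective a := by
    intro s₁ s₂ h12
    by_contra hne
    have h1 := hsep s₁ s₁.2 s₂ s₂.2 (fun h => hne (Subtype.ext h)) (a s₁)
    have h2 := ENNReal.add_lt_add (ha s₁) (ha s₂)
    rw [← h12] at h2
    exact absurd h1 (not_le.2 h2)
  have hbij : Function.Bijective a := hinj.bijective_of_nat_card_le (by simp [hN])
  refine ⟨Equiv.ofBijective a hbij, fun s => ?_⟩
  rw [ENNReal.ofReal_mul hr.le, mul_assoc]
  refine le_trans ?_ (key s s.2)
  gcongr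
  rw [PMF.toOuterMeasure_eq_expect, ← PMF.expect_const_mul]
  refine PMF.expect_mono fun x _ => ?_
  by_cases hx : φ x = a s
  · simp [hx]
  -- By surjectivity a wrong label is the label of another state `s'`, hence within `β` of `s'` and,
  -- by separation, at least `β` from `s`.
  · obtain ⟨s', hs'⟩ := hbij.2 (φ x)
    have hne : (s : S) ≠ s' := by
      intro h
      exact hx (by rw [← hs', Subtype.ext h])
    have h1 := hsep s s.2 s' s'.2 hne (φ x)
    have h2 := ha s'
    rw [hs'] at h2
    have h3 : ENNReal.ofReal β ≤ d s (φ x) := by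
      by_contra hlt
      exact absurd h1 (not_le.2 (ENNReal.add_lt_add (not_le.1 hlt) h2))
    simpa [hx] using h3

end Factored

end BlockMDP

/-! ### Values, optimality and exact relabelling -/

variable {X S Z A : Type*}

/-- The tabular MDP on `Z` obtained by relabelling the states of `M` with `enc`, the dynamics at
`z` being those of the state `inv z`. -/
def TabularMDP.relabel (M : TabularMDP S A) (enc : S → Z) (inv : Z → S) : TabularMDP Z A where
  init := M.init.map enc
  trans z a := (M.trans (inv z) a).map enc
  reward z := M.reward (inv z)
  reward_nonneg z := M.reward_nonneg (inv z)
  reward_le_one z := M.reward_le_one (inv z)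

/-- The optimal total reward over the next `m` steps. -/
def TabularMDP.optValue (M : TabularMDP S A) : ℕ → S → ℝ≥0∞
  | 0, _ => 0
  | m + 1, s => ⨆ a, ENNReal.ofReal (M.reward s a) + (M.trans s a).expect (M.optValue m)

namespace BlockMDP

/-- The expected total reward over the next `m` steps from the state `s` at time `t`. -/
def valueFrom (M : BlockMDP X S A) (π : ObsPolicy X A) : ℕ → ℕ → S → ℝ≥0∞
  | 0, _, _ => 0
  | m + 1, t, s => (M.emit s).expect fun x => (π t x).expect fun a =>
      ENNReal.ofReal (M.reward s a) + (M.trans s a).expect (M.valueFrom π m (t + 1))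

lemma expect_episodeFrom_reward (M : BlockMDP X S A) (π : ObsPolicy X A) (m t : ℕ) (s : S) :
    (M.episodeFrom π m t s).expect
        (fun τ => ∑ h : Fin m, ENNReal.ofReal (M.reward (τ h).1 (τ h).2.2)) =
      M.valueFrom π m t s := by
  induction m generalizing t s with
  | zero => simp [episodeFrom, valueFrom]
  | succ m ih =>
    rw [expect_episodeFrom_succ, valueFrom]
    simp only [Fin.sum_univ_succ, Fin.cons_zero, Fin.cons_succ]
    simp_rw [PMF.expect_add, PMF.expect_const, ih]

lemma value_eq (M : BlockMDP X S A) (H : ℕ) (π : ObsPolicy X A) :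
    M.value H π = (M.init.expect (M.valueFrom π H 0)).toReal := by
  have h0 : ∀ τ : Fin H → S × X × A,
      ∑ h : Fin H, ENNReal.ofReal (M.reward (τ h).1 (τ h).2.2) =
        ENNReal.ofReal (∑ h : Fin H, M.reward (τ h).1 (τ h).2.2) := fun τ =>
    (ENNReal.ofReal_sum_of_nonneg fun h _ => M.reward_nonneg _ _).symm
  have h1 : M.init.expect (M.valueFrom π H 0) = (M.episode π H).expect
      fun τ => ENNReal.ofReal (∑ h : Fin H, M.reward (τ h).1 (τ h).2.2) := by
    rw [episode, PMF.expect_bind]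
    refine PMF.expect_congr fun s _ => ?_
    rw [← expect_episodeFrom_reward]
    simp_rw [h0]
  rw [h1, PMF.expect, ENNReal.tsum_toReal_eq, value]
  · refine tsum_congr fun τ => ?_
    rw [ENNReal.toReal_mul, ENNReal.toReal_ofReal (Finset.sum_nonneg fun h _ =>
      M.reward_nonneg _ _)]
  · exact fun τ => ENNReal.mul_ne_top (PMF.apply_ne_top _ _) ENNReal.ofReal_ne_top

lemma valueFrom_le (M : BlockMDP X S A) (π : ObsPolicy X A) (m t : ℕ) (s : S) :
    M.valueFrom π m t s ≤ m := by
  induction m generalizing t s with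
  | zero => simp [valueFrom]
  | succ m ih =>
    rw [valueFrom]
    refine PMF.expect_le_of_le fun x _ => PMF.expect_le_of_le fun a _ => ?_
    rw [Nat.cast_succ, add_comm]
    refine add_le_add (PMF.expect_le_of_le fun s' _ => ih _ _) ?_
    exact ENNReal.ofReal_le_one.2 (M.reward_le_one s a)

lemma expect_valueFrom_ne_top (M : BlockMDP X S A) (π : ObsPolicy X A) (m t : ℕ) :
    M.init.expect (M.valueFrom π m t) ≠ ⊤ :=
  ne_top_of_le_ne_top (ENNReal.natCast_ne_top m)
    (PMF.expect_le_of_le fun s _ => M.valueFrom_le π m t s)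

/-- Observations carry no advantage: rewards and transitions see only state and action, and an
average over actions is at most the supremum. -/
lemma valueFrom_le_optValue (M : BlockMDP X S A) (π : ObsPolicy X A) (m t : ℕ) (s : S) :
    M.valueFrom π m t s ≤ M.optValue m s := by
  induction m generalizing t s with
  | zero => simp [valueFrom]
  | succ m ih =>
    rw [valueFrom, TabularMDP.optValue]
    refine PMF.expect_le_of_le fun x _ => PMF.expect_le_of_le fun a _ => ?_
    refine le_iSup_of_le a ?_
    gcongr
    exact PMF.expect_mono fun s' _ => ih _ _

lemma expect_emit_comp_dec (M : BlockMDP X S A) (s : S) (g : S → ℝ≥0∞) :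
    ((M.emit s).expect fun x => g (M.dec x)) = g s := by
  rw [← (M.emit s).expect_const (g s)]
  exact PMF.expect_congr fun x hx => by rw [M.dec_of_mem_support s x hx]

lemma mem_reach_succ (M : BlockMDP X S A) {t : ℕ} {s s' : S} {a : A} (hs : s ∈ M.reach t)
    (h : s' ∈ (M.trans s a).support) : s' ∈ M.reach (t + 1) := ⟨s, hs, a, h⟩

section Relabel

variable (M : BlockMDP X S A) (enc : S → Z) (inv : Z → S) {H : ℕ}
  -- States first reached at time `H` may be mislabelled: neither rewards nor transcripts involve
  -- them.
  (hinv : ∀ t < H, ∀ s ∈ M.reach t, inv (enc s) = s)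

include hinv

lemma optValue_relabel {m t : ℕ} (ht : t + m ≤ H) {s : S} (hs : s ∈ M.reach t) :
    (M.toTabularMDP.relabel enc inv).optValue m (enc s) = M.optValue m s := by
  induction m generalizing t s with
  | zero => rfl
  | succ m ih =>
    rw [TabularMDP.optValue, TabularMDP.optValue]
    refine iSup_congr fun a => ?_
    simp only [TabularMDP.relabel, hinv t (by omega) s hs, PMF.expect_map]
    congr 1
    exact PMF.expect_congr fun s' hs' => ih (by omega) (M.mem_reach_succ hs hs')

lemma valueFrom_relabel (ψ : ℕ → Z → A) {m t : ℕ} (ht : t + m ≤ H) {s : S}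
    (hs : s ∈ M.reach t) :
    (M.toTabularMDP.relabel enc inv).toBlock.valueFrom (composePolicy ψ id) m t (enc s) =
      M.valueFrom (composePolicy ψ fun x => enc (M.dec x)) m t s := by
  induction m generalizing t s with
  | zero => rfl
  | succ m ih =>
    rw [valueFrom, valueFrom]
    simp only [composePolicy, PMF.expect_pure]
    rw [M.expect_emit_comp_dec s fun s' => ENNReal.ofReal (M.reward s (ψ t (enc s'))) +
      (M.trans s (ψ t (enc s'))).expect
        (M.valueFrom (composePolicy ψ fun x => enc (M.dec x)) m (t + 1))]
    simp only [TabularMDP.toBlock, PMF.expect_pure, id, TabularMDP.relabel,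
      hinv t (by omega) s hs, PMF.expect_map]
    congr 1
    exact PMF.expect_congr fun s' hs' => ih (by omega) (M.mem_reach_succ hs hs')

lemma value_relabel (ψ : ℕ → Z → A) :
    (M.toTabularMDP.relabel enc inv).toBlock.value H (composePolicy ψ id) =
      M.value H (composePolicy ψ fun x => enc (M.dec x)) := by
  rw [value_eq, value_eq]
  congr 1
  simp only [TabularMDP.toBlock, TabularMDP.relabel, PMF.expect_map]
  exact PMF.expect_congr fun s hs => M.valueFrom_relabel enc inv hinv ψ (by omega) hs

lemma playFrom_relabel (L : TabularLearner Z A) (past : List (Transcript Z A)) {m t : ℕ}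
    (ht : t + m ≤ H) (cur : Transcript Z A) {s : S} (hs : s ∈ M.reach t) :
    L.playFrom (M.toTabularMDP.relabel enc inv).toBlock id past m cur (enc s) =
      L.playFrom M (fun x => enc (M.dec x)) past m cur s := by
  induction m generalizing t s cur with
  | zero => rfl
  | succ m ih =>
    refine PMF.ext_expect fun g => ?_
    rw [TabularLearner.playFrom, TabularLearner.playFrom]
    simp_rw [PMF.expect_bind]
    rw [M.expect_emit_comp_dec s fun s₁ => (L.act past cur (enc s₁)).expect fun a =>
      (M.trans s a).expect fun s' => (L.playFrom M (fun x => enc (M.dec x)) past m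
        (cur ++ [(enc s₁, a, M.reward s a)]) s').expect g]
    simp only [TabularMDP.toBlock, PMF.expect_pure, id, TabularMDP.relabel,
      hinv t (by omega) s hs, PMF.expect_map]
    refine PMF.expect_congr fun a _ => PMF.expect_congr fun s' hs' => ?_
    have := ih (by omega) (cur ++ [(enc s, a, M.reward s a)]) (M.mem_reach_succ hs hs')
    rw [← this]
    rfl

/-- An exactly decoded observation is the label of its state, so the learner's transcripts have the
same law in both environments. -/
lemma run_relabel (L : TabularLearner Z A) (e : ℕ) :
    L.run (M.toTabularMDP.relabel enc inv).toBlock id H e =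
      L.run M (fun x => enc (M.dec x)) H e := by
  have h : L.playEpisodes (M.toTabularMDP.relabel enc inv).toBlock id H e =
      L.playEpisodes M (fun x => enc (M.dec x)) H e := by
    induction e with
    | zero => rfl
    | succ e ih =>
      rw [TabularLearner.playEpisodes, TabularLearner.playEpisodes, ih]
      congr 1
      funext past
      congr 1
      refine PMF.ext_expect fun g => ?_
      rw [PMF.expect_bind, PMF.expect_bind]
      change ((M.init.map enc).expect _) = _
      rw [PMF.expect_map]
      refine PMF.expect_congr fun s hs => ?_
      rw [M.playFrom_relabel enc inv hinv L past (zero_add H).le [] hs]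
  rw [TabularLearner.run, TabularLearner.run, h]

end Relabel

/-- A greedy deterministic policy attains the optimal value of a tabular MDP. -/
lemma exists_valueFrom_eq_optValue [Finite A] [Nonempty A] (M : TabularMDP Z A) (H : ℕ) :
    ∃ ψ : ℕ → Z → A, ∀ m t z, t + m = H →
      M.toBlock.valueFrom (composePolicy ψ id) m t z = M.optValue m z := by
  have hex : ∀ (t : ℕ) (z : Z), ∃ a, ENNReal.ofReal (M.reward z a) +
      (M.trans z a).expect (M.optValue (H - t - 1)) =
      ⨆ a, ENNReal.ofReal (M.reward z a) + (M.trans z a).expect (M.optValue (H - t - 1)) :=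
    fun t z => exists_eq_ciSup_of_finite
  choose ψ hψ using hex
  refine ⟨ψ, fun m => ?_⟩
  induction m with
  | zero => intro t z _; rfl
  | succ m ih =>
    intro t z ht
    rw [TabularMDP.optValue, show m = H - t - 1 by omega, ← hψ, valueFrom]
    simp only [composePolicy, TabularMDP.toBlock, PMF.expect_pure, id]
    congr 1
    refine PMF.expect_congr fun s' _ => ?_
    rw [show H - t - 1 = m by omega]
    exact ih (t + 1) s' (by omega)

/-! ### Effect of decoding errors on values and on the learner -/

section Perturbation

variable (M : BlockMDP X S A) {φ φ' : X → Z} {H : ℕ} {e : ℝ≥0∞}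
  (he : ∀ t < H, ∀ s ∈ M.reach t, (M.emit s).toOuterMeasure {x | φ x ≠ φ' x} ≤ e)

include he

lemma valueFrom_le_add (ψ : ℕ → Z → A) {m t : ℕ} (ht : t + m ≤ H) {s : S}
    (hs : s ∈ M.reach t) :
    M.valueFrom (composePolicy ψ φ') m t s ≤
      M.valueFrom (composePolicy ψ φ) m t s + m * (H * e) := by
  induction m generalizing t s with
  | zero => simp [valueFrom]
  | succ m ih =>
    rw [valueFrom, valueFrom]
    simp only [composePolicy, PMF.expect_pure]
    -- A decoding error now forfeits at most the remaining `m + 1 ≤ H` rewards; without one, the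
    -- induction hypothesis pays for later errors.
    refine (PMF.expect_le_add_of_compl (b := (m + 1 : ℕ)) (c := m * (H * e))
      (v := fun x => ENNReal.ofReal (M.reward s (ψ t (φ x))) +
        (M.trans s (ψ t (φ x))).expect
          (M.valueFrom (composePolicy ψ φ) m (t + 1)))
      (he t (by omega) s hs) (fun x => ?_) fun x hx => ?_).trans ?_
    · rw [Nat.cast_succ, add_comm]
      refine add_le_add (PMF.expect_le_of_le fun s' _ => M.valueFrom_le _ _ _ _) ?_
      exact ENNReal.ofReal_le_one.2 (M.reward_le_one s _)
    · have hx' : φ x = φ' x := by simpa using hx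
      rw [hx', add_assoc, ← PMF.expect_add_const]
      gcongr
      exact PMF.expect_mono fun s' hs' => ih (by omega) (M.mem_reach_succ hs hs')
    · rw [add_assoc]
      refine add_le_add le_rfl ?_
      have hmul : ((m + 1 : ℕ) : ℝ≥0∞) * (H * e) = m * (H * e) + H * e := by
        rw [Nat.cast_succ, add_mul, one_mul]
      rw [hmul]
      gcongr
      exact_mod_cast (by omega : m + 1 ≤ H)

lemma value_le_add (ψ : ℕ → Z → A) (hfin : e ≠ ⊤) :
    M.value H (composePolicy ψ φ') ≤
      M.value H (composePolicy ψ φ) + (H : ℝ) * (H * e.toReal) := by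
  have h : M.init.expect (M.valueFrom (composePolicy ψ φ') H 0) ≤
      M.init.expect (M.valueFrom (composePolicy ψ φ) H 0) + H * (H * e) := by
    rw [← PMF.expect_add_const]
    exact PMF.expect_mono fun s hs => M.valueFrom_le_add he ψ (by omega) hs
  have hc : (H : ℝ≥0∞) * (H * e) ≠ ⊤ := ENNReal.mul_ne_top (ENNReal.natCast_ne_top _)
    (ENNReal.mul_ne_top (ENNReal.natCast_ne_top _) hfin)
  have := ENNReal.toReal_mono
    (ENNReal.add_ne_top.2 ⟨M.expect_valueFrom_ne_top (composePolicy ψ φ) H 0, hc⟩) h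
  rw [ENNReal.toReal_add (M.expect_valueFrom_ne_top _ H 0) hc] at this
  simpa [value_eq] using this

/-- A coupling argument phrased with test functions: the two runs agree until the first decoding
error, which has probability at most `e` per step. -/
lemma expect_playFrom_le (L : TabularLearner Z A) (past : List (Transcript Z A))
    {g : Transcript Z A → ℝ≥0∞} (hg : ∀ τ, g τ ≤ 1) {m t : ℕ} (ht : t + m ≤ H)
    (cur : Transcript Z A) {s : S} (hs : s ∈ M.reach t) :
    (L.playFrom M φ' past m cur s).expect g ≤
      (L.playFrom M φ past m cur s).expect g + m * e := by
  induction m generalizing t s cur with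
  | zero => simp [TabularLearner.playFrom]
  | succ m ih =>
    rw [TabularLearner.playFrom, TabularLearner.playFrom]
    simp_rw [PMF.expect_bind]
    refine (PMF.expect_le_add_of_compl (b := 1) (c := m * e)
      (v := fun x => (L.act past cur (φ x)).expect fun a => (M.trans s a).expect fun s' =>
        (L.playFrom M φ past m (cur ++ [(φ x, a, M.reward s a)]) s').expect g)
      (he t (by omega) s hs) (fun x => ?_) fun x hx => ?_).trans ?_
    · exact PMF.expect_le_of_le fun a _ => PMF.expect_le_of_le fun s' _ =>
        PMF.expect_le_of_le fun τ _ => hg τ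
    · have hx' : φ x = φ' x := by simpa using hx
      rw [hx', ← PMF.expect_add_const]
      refine PMF.expect_mono fun a _ => ?_
      rw [← PMF.expect_add_const]
      exact PMF.expect_mono fun s' hs' => ih (by omega) _ (M.mem_reach_succ hs hs')
    · rw [add_assoc, Nat.cast_succ, add_mul]

lemma expect_playEpisodes_le (L : TabularLearner Z A) {g : List (Transcript Z A) → ℝ≥0∞}
    (hg : ∀ τ, g τ ≤ 1) (n : ℕ) :
    (L.playEpisodes M φ' H n).expect g ≤
      (L.playEpisodes M φ H n).expect g + n * (H * e) := by
  induction n generalizing g with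
  | zero => simp [TabularLearner.playEpisodes]
  | succ n ih =>
    rw [TabularLearner.playEpisodes, TabularLearner.playEpisodes]
    simp_rw [PMF.expect_bind, PMF.expect_map, PMF.expect_bind]
    refine (ih fun past => PMF.expect_le_of_le fun s _ =>
      PMF.expect_le_of_le fun τ _ => hg _).trans ?_
    rw [Nat.cast_succ, add_mul, one_mul, add_comm (n * (H * e) : ℝ≥0∞), ← add_assoc]
    gcongr
    rw [← PMF.expect_add_const]
    refine PMF.expect_mono fun past _ => ?_
    rw [← PMF.expect_add_const]
    exact PMF.expect_mono fun s hs =>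
      M.expect_playFrom_le he L past (fun τ => hg _) (t := 0) (zero_add H).le [] hs

lemma toOuterMeasure_run_le (L : TabularLearner Z A) (n : ℕ) (B : Set (ℕ → Z → A)) :
    (L.run M φ' H n).toOuterMeasure B ≤
      (L.run M φ H n).toOuterMeasure B + n * (H * e) := by
  rw [PMF.toOuterMeasure_eq_expect, PMF.toOuterMeasure_eq_expect, TabularLearner.run,
    TabularLearner.run, PMF.expect_bind, PMF.expect_bind]
  refine M.expect_playEpisodes_le he L (fun τ => PMF.expect_le_of_le fun ϕ _ => ?_) n
  by_cases h : ϕ ∈ B <;> simp [h]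

end Perturbation

/-- A policy that is nearly optimal in the relabelled tabular MDP remains nearly optimal in the
Block MDP when it is composed with an approximate decoder. -/
lemma value_sub_le [Finite A] [Nonempty A] (M : BlockMDP X S A) (enc : S → Z) (inv : Z → S)
    {H : ℕ} (hinv : ∀ t < H, ∀ s ∈ M.reach t, inv (enc s) = s) {φ : X → Z} {e : ℝ≥0∞}
    (he : ∀ t < H, ∀ s ∈ M.reach t,
      (M.emit s).toOuterMeasure {x | φ x ≠ enc (M.dec x)} ≤ e)
    (hfin : e ≠ ⊤) {ϕ : ℕ → Z → A} {ε : ℝ}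
    (hϕ : ∀ ψ : ℕ → Z → A,
      (M.toTabularMDP.relabel enc inv).toBlock.value H (composePolicy ψ id) -
        (M.toTabularMDP.relabel enc inv).toBlock.value H (composePolicy ϕ id) ≤ ε)
    (π : ObsPolicy X A) :
    M.value H π - M.value H (composePolicy ϕ φ) ≤ ε + (H : ℝ) * (H * e.toReal) := by
  obtain ⟨ψ, hψ⟩ := exists_valueFrom_eq_optValue (M.toTabularMDP.relabel enc inv) H
  have h1 : M.value H π ≤
      (M.toTabularMDP.relabel enc inv).toBlock.value H (composePolicy ψ id) := by
    rw [M.value_relabel enc inv hinv, value_eq, value_eq]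
    refine ENNReal.toReal_mono (M.expect_valueFrom_ne_top _ H 0) ?_
    refine PMF.expect_mono fun s hs => ?_
    rw [← M.valueFrom_relabel enc inv hinv ψ (by omega : 0 + H ≤ H) hs, hψ H 0 _ (by omega),
      M.optValue_relabel enc inv hinv (by omega : 0 + H ≤ H) hs]
    exact M.valueFrom_le_optValue π H 0 s
  have h2 := M.value_le_add he ϕ hfin
  have h3 := hϕ ψ
  rw [M.value_relabel enc inv hinv ϕ] at h3
  linarith

end BlockMDP

/-! ### Failure budgets and sample size -/

lemma ofReal_one_sub_le_of_add_le {a b δ₁ δ₂ : ℝ} {p q : ℝ≥0∞} (ha : a = 1 - δ₁)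
    (h : ENNReal.ofReal a ≤ p + q) (hq : q ≤ ENNReal.ofReal δ₂) (hb : b = 1 - (δ₁ + δ₂))
    (hδ₂ : 0 ≤ δ₂) : ENNReal.ofReal b ≤ p := by
  have : ENNReal.ofReal b = ENNReal.ofReal a - ENNReal.ofReal δ₂ := by
    rw [← ENNReal.ofReal_sub _ hδ₂, ha, hb, sub_sub]
  rw [this, tsub_le_iff_right]
  exact h.trans (by gcongr)

section SampleSize

variable {N H η β L n : ℝ}

lemma sampleSize_mul_le {B : ℝ} (hn : 0 < n) (h : 256 * B * L ≤ n) :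
    B * (1 / n * L) ≤ 1 / 256 := by
  have : B * (1 / n * L) = B * L / n := by ring
  rw [this, div_le_div_iff₀ hn (by norm_num)]
  linarith

lemma sampleSize_sqrt_lt (hN : 1 ≤ N) (hH : 1 ≤ H) (hη : 0 < η) (hη1 : η ≤ 1) (hβ : 0 < β)
    {l : ℝ} (h : N ^ 4 * H ^ 4 / (η ^ 4 * β ^ 2) * l ≤ 1 / 256) :
    2 * √(6 * l) < η / H * β := by
  have hH0 : 0 < H := by linarith
  have h1 : l ≤ η ^ 4 * β ^ 2 / (256 * (N ^ 4 * H ^ 4)) := by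
    rw [le_div_iff₀ (by positivity)]
    rw [div_mul_eq_mul_div, div_le_div_iff₀ (by positivity) (by norm_num)] at h
    linarith
  have h2 : η ^ 4 * β ^ 2 / (256 * (N ^ 4 * H ^ 4)) ≤ (η / H * β) ^ 2 / 256 := by
    have e : (η / H * β) ^ 2 / 256 = η ^ 2 * β ^ 2 / (256 * (1 * H ^ 2)) := by
      field_simp
    rw [e]
    have hη2 : η ^ 4 ≤ η ^ 2 := pow_le_pow_of_le_one hη.le hη1 (by norm_num)
    have hH2 : H ^ 2 ≤ H ^ 4 := pow_le_pow_right₀ hH (by norm_num)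
    have hN2 : 1 ≤ N ^ 4 := one_le_pow₀ hN
    gcongr
  have hpos : 0 < η / H * β := by positivity
  have h3 : √(6 * l) < η / H * β / 2 := by
    rw [Real.sqrt_lt' (by positivity)]
    nlinarith [sq_pos_of_pos hpos]
  linarith

lemma le_of_sq_mul_le {c l d : ℝ} (hl : 0 ≤ l) (hd : 0 < d)
    (h : c ^ 2 / d ^ 2 * l ≤ 1 / 256) : 4 * (c * √l) ≤ d / 4 := by
  have h1 : (c * √l) ^ 2 ≤ (d / 16) ^ 2 := by
    rw [mul_pow, Real.sq_sqrt hl]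
    rw [div_mul_eq_mul_div, div_le_div_iff₀ (by positivity) (by norm_num)] at h
    nlinarith
  have := abs_le_of_sq_le_sq' h1 (by positivity)
  linarith [this.2]

end SampleSize

namespace BlockMDP

variable {X S : Type*}

/-- The constants compare as `2√6 ≤ 4N³`, which fails for `N = 1`. -/
lemma toOuterMeasure_ne_le {N : ℕ} {p : ℝ≥0∞} {H η β l : ℝ} (hN : 2 ≤ N) (hH : 1 ≤ H)
    (hη : 0 < η) (hη1 : η ≤ 1) (hβ : 0 < β)
    (h : ENNReal.ofReal (η / H * β) * p ≤ ENNReal.ofReal (2 * √(6 * l))) :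
    p ≤ ENNReal.ofReal (4 * (N : ℝ) ^ 3 * H ^ 2 / (η ^ 2 * β) * √l) := by
  have hr : 0 < η / H * β := by positivity
  have hN' : (2 : ℝ) ≤ N := by exact_mod_cast hN
  rw [mul_comm, ← ENNReal.le_div_iff_mul_le (Or.inl (ENNReal.ofReal_pos.2 hr).ne')
    (Or.inl ENNReal.ofReal_ne_top), ← ENNReal.ofReal_div_of_pos hr] at h
  refine h.trans (ENNReal.ofReal_le_ofReal ?_)
  rw [div_le_iff₀ hr]
  have e : 4 * (N : ℝ) ^ 3 * H ^ 2 / (η ^ 2 * β) * √l * (η / H * β) =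
      (4 * (N : ℝ) ^ 3) * (H / η) * √l := by
    field_simp
  have h8 : (2 : ℝ) ^ 3 ≤ (N : ℝ) ^ 3 := by gcongr
  have h1 : 1 ≤ H / η := by rw [le_div_iff₀ hη]; linarith
  have h6 : √6 ≤ 3 := by rw [Real.sqrt_le_left (by norm_num)]; norm_num
  rw [e, Real.sqrt_mul (by norm_num), ← mul_assoc]
  refine mul_le_mul_of_nonneg_right ?_ (Real.sqrt_nonneg _)
  nlinarith

/-- With an accurate decoder, the tabular algorithm returns a nearly optimal policy. -/
lemma le_toOuterMeasure_run {A H N : ℕ} [NeZero A] (M : BlockMDP X S (Fin A))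
    {alg : TabularAlgorithm} (halg : alg.IsPAC) {ε δ e : ℝ} (hε : 0 < ε) (hδ : 0 < δ)
    (hδ1 : δ < 1) (he : 0 ≤ e) (α : M.visited H ≃ Fin N) [NeZero N] (φ : X → Fin N)
    (hφ : ∀ s : M.visited H, (M.emit s).toOuterMeasure {x | φ x ≠ α s} ≤ ENNReal.ofReal e)
    (h1 : (alg.nsamp N A H (ε / 2) (δ / 4) : ℝ) * (H * e) ≤ δ / 4)
    (h2 : (H : ℝ) * (H * e) ≤ ε / 4) :
    ENNReal.ofReal (1 - δ / 2) ≤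
      ((alg.learner N A H (ε / 2) (δ / 4)).run M φ H
        (alg.nsamp N A H (ε / 2) (δ / 4))).toOuterMeasure
          {ϕ | ∀ π : ObsPolicy X (Fin A),
            M.value H π - M.value H (composePolicy ϕ φ) ≤ ε} := by
  classical
  -- The default label `0` of unvisited states is harmless, since they cannot occur before time `H`.
  set enc : S → Fin N := fun s => if h : s ∈ M.visited H then α ⟨s, h⟩ else 0 with henc
  set inv : Fin N → S := fun i => α.symm i with hinv
  have hvis : ∀ t < H, ∀ s ∈ M.reach t, s ∈ M.visited H := fun t ht s hs =>
    M.reach_subset_visited ht hs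
  have hei : ∀ t < H, ∀ s ∈ M.reach t, inv (enc s) = s := by
    intro t ht s hs
    simp [henc, hinv, hvis t ht s hs]
  have herr : ∀ t < H, ∀ s ∈ M.reach t,
      (M.emit s).toOuterMeasure {x | φ x ≠ enc (M.dec x)} ≤ ENNReal.ofReal e := by
    intro t ht s hs
    have hs' := hvis t ht s hs
    refine le_trans (le_of_eq ?_) (hφ ⟨s, hs'⟩)
    rw [PMF.toOuterMeasure_eq_expect, PMF.toOuterMeasure_eq_expect]
    refine PMF.expect_congr fun x hx => ?_
    simp [Set.indicator, henc, M.dec_of_mem_support s x hx, hs']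
  have hpac := halg N A H (ε / 2) (δ / 4) (by positivity) (by positivity) (by linarith)
    (M.toTabularMDP.relabel enc inv)
  rw [M.run_relabel enc inv hei] at hpac
  have hrun := hpac.trans (M.toOuterMeasure_run_le herr _ _ _)
  -- One `δ/4` is the PAC failure, the other the chance of a decoding error online.
  refine (ofReal_one_sub_le_of_add_le (b := 1 - δ / 2) (δ₁ := δ / 4) (δ₂ := δ / 4) rfl hrun ?_
    (by ring) (by positivity)).trans ?_
  · rw [← ENNReal.ofReal_natCast, ← ENNReal.ofReal_natCast (n := H), ← ENNReal.ofReal_mul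
      (by positivity), ← ENNReal.ofReal_mul (by positivity)]
    exact ENNReal.ofReal_le_ofReal h1
  · refine PMF.toOuterMeasure_mono _ ?_
    rintro ϕ ⟨hϕ, -⟩ π
    have := M.value_sub_le enc inv hei herr ENNReal.ofReal_ne_top hϕ π
    rw [ENNReal.toReal_ofReal he] at this
    linarith

end BlockMDP

end

theorem theorem1 :
    ∃ C : ℝ, 0 < C ∧
      ∀ (alg : TabularAlgorithm), alg.IsPAC →
      ∀ (X S : Type*) [Fintype S] (A H K N : ℕ) [NeZero A] [NeZero H]
        (M : BlockMDP X S (Fin A)),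
        N = Nat.card (M.visited H) →
      ∀ (Pol : Set (ObsPolicy X (Fin A))) (Θ : PMF (ObsPolicy X (Fin A))) (ω : PMF (Fin K))
        (F : Finset (Fin N → Fin K → PMF X)) (Φ : Finset (X → Fin N)) (η β ε δ : ℝ),
        0 < η → M.Covers H Pol Θ η → M.NoiseFree Θ →
        Realizable (M.multistepLaw Θ H K ω) F Φ →
        0 < β → ForwardMargin (M.multistepLaw Θ H K ω) M.dec ω (M.visited H) β →
        0 < ε → 0 < δ → δ < 1 →
      ∀ n : ℕ,
        C * ((N : ℝ) ^ 4 * (H : ℝ) ^ 4 / (η ^ 4 * β ^ 2)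
            + (N : ℝ) ^ 6 * (H : ℝ) ^ 8 / (ε ^ 2 * η ^ 4 * β ^ 2)
            + (N : ℝ) ^ 6 * (H : ℝ) ^ 6 * (alg.nsamp N A H (ε / 2) (δ / 4) : ℝ) ^ 2
                / (δ ^ 2 * η ^ 4 * β ^ 2))
          * Real.log ((F.card : ℝ) * (Φ.card : ℝ) / δ) ≤ (n : ℝ) →
      ∀ est : (Fin n → X × Fin K × X) → (Fin N → Fin K → PMF X) × (X → Fin N),
        (∀ data, IsMaxLikelihood F Φ data (est data)) →
        ENNReal.ofReal (1 - δ) ≤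
          ((iidLaw (M.multistepLaw Θ H K ω) n).bind fun data =>
            ((alg.learner N A H (ε / 2) (δ / 4)).run M (est data).2 H
                (alg.nsamp N A H (ε / 2) (δ / 4))).map
              fun ϕ => ((est data).2, ϕ)).toOuterMeasure
            {r : (X → Fin N) × (ℕ → Fin N → Fin A) |
              (∃ α : M.visited H ≃ Fin N, ∀ s : M.visited H,
                1 - 4 * (N : ℝ) ^ 3 * (H : ℝ) ^ 2 / (η ^ 2 * β)
                    * Real.sqrt (1 / (n : ℝ)
                        * Real.log ((F.card : ℝ) * (Φ.card : ℝ) / δ))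
                  ≤ ((M.emit s.1).toOuterMeasure {x | r.1 x = α s}).toReal) ∧
              ∀ π : ObsPolicy X (Fin A),
                M.value H π - M.value H (composePolicy r.2 r.1) ≤ ε} := by
  classical
  -- `256 = 16²`: the decoding error carries a factor `4` and may consume only a quarter of `ε` or
  -- `δ`.
  refine ⟨256, by norm_num, ?_⟩
  intro alg halg X S _ A H K N _ _ M hN Pol Θ ω F Φ η β ε δ hη hcov hnf hreal hβ hmarg hε hδ hδ1
    n hn est hest
  obtain ⟨W, hW, hP⟩ := M.exists_multistepLaw_eq Θ H K ω hnf
  set P := M.multistepLaw Θ H K ω with hPdef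
  set L := Real.log ((F.card : ℝ) * (Φ.card : ℝ) / δ) with hL
  set ns := alg.nsamp N A H (ε / 2) (δ / 4) with hns
  have hHpos : 0 < H := Nat.pos_of_ne_zero (NeZero.ne H)
  have hH1 : (1 : ℝ) ≤ H := by exact_mod_cast hHpos
  obtain ⟨s₀, hs₀⟩ := M.init.support_nonempty
  have hs₀' : s₀ ∈ M.visited H := M.reach_subset_visited hHpos hs₀
  have hη1 : η ≤ 1 := M.eta_le_one hcov hs₀'
  have hNpos : 0 < N := by
    have : Nonempty (M.visited H) := ⟨⟨s₀, hs₀'⟩⟩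
    rw [hN]
    exact Nat.card_pos
  have : NeZero N := ⟨hNpos.ne'⟩
  have hN1 : (1 : ℝ) ≤ N := by exact_mod_cast hNpos
  have hLpos : 0 < L := by
    obtain ⟨f, hf, φ, hφ, -⟩ := hreal
    have hF : (1 : ℝ) ≤ F.card := by exact_mod_cast Finset.card_pos.2 ⟨f, hf⟩
    have hΦ : (1 : ℝ) ≤ Φ.card := by exact_mod_cast Finset.card_pos.2 ⟨φ, hφ⟩
    refine Real.log_pos ?_
    rw [lt_div_iff₀ hδ]
    nlinarith
  have hnpos : (0 : ℝ) < n := lt_of_lt_of_le (by positivity) hn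
  set l := 1 / (n : ℝ) * L with hl
  have hlpos : 0 < l := by positivity
  have hsum := sampleSize_mul_le hnpos hn
  rw [← hl, add_mul, add_mul] at hsum
  have t₁ : 0 ≤ (N : ℝ) ^ 4 * (H : ℝ) ^ 4 / (η ^ 4 * β ^ 2) * l := by positivity
  have t₂ : 0 ≤ (N : ℝ) ^ 6 * (H : ℝ) ^ 8 / (ε ^ 2 * η ^ 4 * β ^ 2) * l := by positivity
  have t₃ : 0 ≤ (N : ℝ) ^ 6 * (H : ℝ) ^ 6 * (ns : ℝ) ^ 2 / (δ ^ 2 * η ^ 4 * β ^ 2) * l := by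
    positivity
  have hsep : 2 * √(6 * l) < η / H * β := sampleSize_sqrt_lt hN1 hH1 hη hη1 hβ (by linarith)
  set e := 4 * (N : ℝ) ^ 3 * (H : ℝ) ^ 2 / (η ^ 2 * β) * √l with he
  have he0 : 0 ≤ e := by positivity
  have hval : (H : ℝ) * (H * e) ≤ ε / 4 := by
    refine (le_of_eq ?_).trans (le_of_sq_mul_le (c := N ^ 3 * H ^ 4 / (η ^ 2 * β)) hlpos.le hε ?_)
    · rw [he]; ring
    · refine (le_of_eq ?_).trans (by linarith :
        (N : ℝ) ^ 6 * (H : ℝ) ^ 8 / (ε ^ 2 * η ^ 4 * β ^ 2) * l ≤ 1 / 256)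
      field_simp
  have hcoup : (ns : ℝ) * (H * e) ≤ δ / 4 := by
    refine (le_of_eq ?_).trans
      (le_of_sq_mul_le (c := N ^ 3 * H ^ 3 * ns / (η ^ 2 * β)) hlpos.le hδ ?_)
    · rw [he]; ring
    · refine (le_of_eq ?_).trans (by linarith :
        (N : ℝ) ^ 6 * (H : ℝ) ^ 6 * (ns : ℝ) ^ 2 / (δ ^ 2 * η ^ 4 * β ^ 2) * l ≤ 1 / 256)
      field_simp
  set good := {data | l1Dist P (modelLaw P (est data).1 (est data).2) ≤
    ENNReal.ofReal (2 * √(6 * l))} with hgood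
  have hgoodp : ENNReal.ofReal (1 - δ / 4) ≤ (iidLaw P n).toOuterMeasure good := by
    have hmle := iidLaw_mle_le P hreal hδ hδ1 (Nat.cast_pos.1 hnpos) est hest
    have hadd := (iidLaw P n).toOuterMeasure_add_compl good
    exact ofReal_one_sub_le_of_add_le (a := 1) (δ₁ := 0) (δ₂ := δ / 4) (by ring)
      (ENNReal.ofReal_one.trans hadd.symm).le hmle (by ring) (by positivity)
  have hcond : ∀ data ∈ good, ENNReal.ofReal (1 - δ / 2) ≤
      ((alg.learner N A H (ε / 2) (δ / 4)).run M (est data).2 H ns).toOuterMeasure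
        {ϕ | (∃ α : M.visited H ≃ Fin N, ∀ s : M.visited H,
          1 - e ≤ ((M.emit s.1).toOuterMeasure {x | (est data).2 x = α s}).toReal) ∧
            ∀ π : ObsPolicy X (Fin A),
              M.value H π - M.value H (composePolicy ϕ (est data).2) ≤ ε} := by
    intro data hdata
    obtain ⟨α, hα⟩ := M.exists_decoding P ω W hP hW (fun s => PMF.apply_ne_top _ s) hN
      (r := η / H) (by positivity) hβ (fun s hs => M.ofReal_div_le_occupancy hcov hs) hmarg
      (est data).1 (est data).2 hsep hdata
    have herr : ∀ s : M.visited H,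
        (M.emit s).toOuterMeasure {x | (est data).2 x ≠ α s} ≤ ENNReal.ofReal e := by
      intro s
      -- With a single label no decoding error is possible.
      rcases Nat.lt_or_ge 1 N with h2 | h2
      · exact BlockMDP.toOuterMeasure_ne_le h2 hH1 hη hη1 hβ (hα s)
      · have : Subsingleton (Fin N) := Fin.subsingleton_iff_le_one.2 h2
        have hempty : {x | (est data).2 x ≠ α s} = ∅ :=
          Set.eq_empty_of_forall_notMem fun x hx => hx (Subsingleton.elim _ _)
        rw [hempty]
        simp
    refine (M.le_toOuterMeasure_run halg hε hδ hδ1 he0 α (est data).2 herr hcoup hval).trans ?_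
    refine PMF.toOuterMeasure_mono _ ?_
    rintro ϕ ⟨hϕ, -⟩
    refine ⟨⟨α, fun s => ?_⟩, hϕ⟩
    have hadd := (M.emit s).toOuterMeasure_add_compl {x | (est data).2 x = α s}
    have hle := ofReal_one_sub_le_of_add_le (a := 1) (b := 1 - e) (δ₁ := 0) (δ₂ := e) (by ring)
      (ENNReal.ofReal_one.trans hadd.symm).le (herr s) (by ring) he0
    exact (ENNReal.ofReal_le_iff_le_toReal (ne_top_of_le_ne_top ENNReal.one_ne_top
      (PMF.toOuterMeasure_le_one _ _))).1 hle
  rw [PMF.toOuterMeasure_eq_expect, PMF.expect_bind]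
  calc ENNReal.ofReal (1 - δ)
      -- The data are good with probability `1 - δ/4`; given good data, the online phase succeeds
      -- with probability `1 - δ/2`.
      ≤ ENNReal.ofReal (1 - δ / 2) * ENNReal.ofReal (1 - δ / 4) := by
        rw [← ENNReal.ofReal_mul (by linarith)]
        exact ENNReal.ofReal_le_ofReal (by nlinarith)
    _ ≤ ENNReal.ofReal (1 - δ / 2) * (iidLaw P n).toOuterMeasure good := by gcongr
    _ = (iidLaw P n).expect fun data => ENNReal.ofReal (1 - δ / 2) * good.indicator 1 data := by
        rw [PMF.toOuterMeasure_eq_expect, PMF.expect_const_mul]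
    _ ≤ _ := by
        refine PMF.expect_mono fun data _ => ?_
        by_cases hd : data ∈ good
        · rw [Set.indicator_of_mem hd, Pi.one_apply, mul_one, PMF.expect_map]
          refine (hcond data hd).trans_eq ?_
          rw [PMF.toOuterMeasure_eq_expect]
          rfl
        · simp [hd]
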